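/- Let $n\ge 1$. On $\mathbb R^{2n+1}$ with coordinates $(x_1,\dots,x_n,y_1,\dots,y_n,z)$ let $\alpha_0=dz-\frac12\sum_i x_i\,dy_i+\frac12\sum_i y_i\,dx_i$, let $\mathcal D=\ker\alpha_0$, and let $\langle\cdot,\cdot\rangle$ be the Riemannian metric for which the frame $X_i=\partial_{x_i}-\frac12y_i\partial_z$, $Y_i=\partial_{y_i}+\frac12x_i\partial_z$, $\partial_z$ is orthonormal; the Heisenberg group is $\mathbb R^{2n+1}$ with the sub-Riemannian structure given by $\mathcal D$ and the restriction of $\langle\cdot,\cdot\rangle$ to $\mathcal D$. Let $H(q,p)=\sup_{v\in\mathcal D_q}\left(p(v)-\frac12|v|^2\right)$ on the cotangent bundle, let $e^{t\vec H}$ be the flow of its Hamiltonian vector field $\vec H$ for the canonical symplectic form, and let $\psi_t(q,p)=\pi(e^{t\vec H}(q,p))$, where $\pi$ is the projection to $\mathbb R^{2n+1}$. Let $(q,p)$ be a covector with $|p^h|=1$, where $p^h\in\mathcal D_q$ is the vector with $p(v)=\langle p^h,v\rangle$ for all $v\in\mathcal D_q$. The cut time of $(q,p)$ is the largest $T>0$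 such that the curve $t\in[0,T]\mapsto\psi_t(q,p)$ is length minimizing, that is, it is horizontal and no horizontal curve (absolutely continuous curve almost everywhere tangent to $\mathcal D$) with the same endpoints is shorter; it is $+\infty$ if there are arbitrarily large such $T$. The first conjugate time of $(q,p)$ is the smallest $t>0$ such that the differential at $p$ of the map $\psi_t(q,\cdot):T_q^*\mathbb R^{2n+1}\to\mathbb R^{2n+1}$ is not bijective; it is $+\infty$ if there is no such $t$. Then $t\in[0,T]\mapsto\psi_t(q,p)$ is length minimizing for some $T>0$, and the cut time of $(q,p)$ equals its first conjugate time; when this common value is finite, the largest $T$ and the smallest $t$ above are attained. -/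

import Mathlib

open MeasureTheory Set
open scoped ENNReal

noncomputable section

namespace Heisenberg

/-- The manifold `ℝ^(2n+1)` with coordinates `(x, y, z)`, `x y : Fin n → ℝ`, `z : ℝ`. As it is a
vector space, it is also the model of each of its tangent spaces. The norm of this type is only used
for the calculus (derivatives, absolute continuity), never as a metric of the geometry. -/
abbrev Space (n : ℕ) : Type := (Fin n → ℝ) × (Fin n → ℝ) × ℝ

/-- The cotangent bundle `T*ℝ^(2n+1)`: pairs `(q, p)` of a point and a covector at it. -/
abbrev Cotangent (n : ℕ) : Type := Space n × (Space n →L[ℝ] ℝ)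

variable {n : ℕ}

/-- The contact form `α₀ = dz - (1/2) ∑ xᵢ dyᵢ + (1/2) ∑ yᵢ dxᵢ` at the point `q`. -/
def contactForm (q : Space n) : Space n →ₗ[ℝ] ℝ where
  toFun v := v.2.2 - 1 / 2 * ∑ i, q.1 i * v.2.1 i + 1 / 2 * ∑ i, q.2.1 i * v.1 i
  map_add' v w := by
    simp only [Prod.fst_add, Prod.snd_add, Pi.add_apply, mul_add, Finset.sum_add_distrib]
    ring
  map_smul' c v := by
    have h : ∀ a b : Fin n → ℝ, ∑ i, a i * (c * b i) = c * ∑ i, a i * b i := fun a b => by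
      rw [Finset.mul_sum]; exact Finset.sum_congr rfl fun i _ => by ring
    simp only [Prod.smul_fst, Prod.smul_snd, Pi.smul_apply, smul_eq_mul, RingHom.id_apply, h]
    ring

/-- The horizontal distribution `ker α₀`. -/
def distribution (q : Space n) : Submodule ℝ (Space n) := LinearMap.ker (contactForm q)

/-- The vector field `Xᵢ = ∂_{xᵢ} - (1/2) yᵢ ∂_z`. -/
def frameX (i : Fin n) (q : Space n) : Space n := (Pi.single i 1, 0, -(1 / 2) * q.2.1 i)

/-- The vector field `Yᵢ = ∂_{yᵢ} + (1/2) xᵢ ∂_z`. -/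
def frameY (i : Fin n) (q : Space n) : Space n := (0, Pi.single i 1, 1 / 2 * q.1 i)

/-- The Riemannian metric `∑ dxᵢ² + ∑ dyᵢ² + α₀²`, that is, the one for which the frame
`Xᵢ, Yᵢ, ∂_z` is orthonormal (see `metric_orthonormal`). Its restriction to `distribution q` is the
sub-Riemannian metric. -/
def metric (q v w : Space n) : ℝ :=
  ∑ i, v.1 i * w.1 i + ∑ i, v.2.1 i * w.2.1 i + contactForm q v * contactForm q w

theorem contactForm_apply (q v : Space n) : contactForm q v =
    v.2.2 - 1 / 2 * ∑ i, q.1 i * v.2.1 i + 1 / 2 * ∑ i, q.2.1 i * v.1 i := rfl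

theorem contactForm_frameX (i : Fin n) (q : Space n) : contactForm q (frameX i q) = 0 := by
  simp [contactForm_apply, frameX, Pi.single_apply]

theorem contactForm_frameY (i : Fin n) (q : Space n) : contactForm q (frameY i q) = 0 := by
  simp [contactForm_apply, frameY, Pi.single_apply]

theorem metric_orthonormal (q : Space n) (i j : Fin n) :
    metric q (frameX i q) (frameX j q) = (if i = j then 1 else 0) ∧
    metric q (frameY i q) (frameY j q) = (if i = j then 1 else 0) ∧
    metric q (frameX i q) (frameY j q) = 0 ∧
    metric q (frameX i q) (0, 0, 1) = 0 ∧ metric q (frameY i q) (0, 0, 1) = 0 ∧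
    metric q (0, 0, 1) (0, 0, 1) = 1 := by
  simp only [metric, contactForm_frameX, contactForm_frameY]
  simp [frameX, frameY, contactForm_apply, Pi.single_apply, eq_comm]

/-- The norm `|v|` of a tangent vector at `q`. -/
def tangentNorm (q v : Space n) : ℝ := Real.sqrt (metric q v v)

/-- The covector `p` at `q` satisfies `|p^h| = 1`, where the horizontal part `p^h` of `p` is the
vector in `ker α₀` with `p(v) = ⟨p^h, v⟩` for all `v` in `ker α₀`. -/
def IsUnitHorizontal (q : Space n) (p : Space n →L[ℝ] ℝ) : Prop :=
  ∃ u ∈ distribution q, (∀ v ∈ distribution q, p v = metric q u v) ∧ tangentNorm q u = 1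

/-! ### The sub-Riemannian geodesic flow -/

/-- The Hamiltonian, as the Legendre transform `H(q, p) = sup_{v ∈ D_q} (p(v) - |v|²/2)`. The
supremum is attained, see `hamiltonian_eq`. -/
def hamiltonian (ξ : Cotangent n) : ℝ :=
  ⨆ v : distribution ξ.1, (ξ.2 v - 1 / 2 * tangentNorm ξ.1 v ^ 2)

/-- The canonical symplectic form `ω = ∑ dpᵢ ∧ dxᵢ` on the cotangent bundle. -/
def symplecticForm (u w : Cotangent n) : ℝ := u.2 w.1 - w.2 u.1

/-- `v` is the value at `ξ` of the Hamiltonian vector field, i.e. `ω(v, ·) = -dH_ξ`. In canonical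
coordinates, `v = ∑ (H_{pᵢ} ∂_{xᵢ} - H_{xᵢ} ∂_{pᵢ})`. -/
def IsHamiltonianVector (ξ v : Cotangent n) : Prop :=
  ∀ w : Cotangent n, symplecticForm v w = -(fderiv ℝ hamiltonian ξ w)

/-- `γ : ℝ → T*M` is the integral curve of the Hamiltonian vector field that starts at `ξ`. -/
def IsTrajectory (ξ : Cotangent n) (γ : ℝ → Cotangent n) : Prop :=
  γ 0 = ξ ∧ ∀ t, ∃ v, IsHamiltonianVector (γ t) v ∧ HasDerivAt γ v t

theorem eq_sum_of_mem_distribution {q v : Space n} (hv : v ∈ distribution q) :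
    v = ∑ i, v.1 i • frameX i q + ∑ i, v.2.1 i • frameY i q := by
  have h : contactForm q v = 0 := hv
  rw [contactForm_apply] at h
  refine Prod.ext ?_ (Prod.ext ?_ ?_)
  · funext j
    simp [frameX, frameY, Prod.fst_sum, Finset.sum_apply, Pi.single_apply]
  · funext j
    simp [frameX, frameY, Prod.fst_sum, Prod.snd_sum, Finset.sum_apply, Pi.single_apply]
  · simp only [frameX, frameY, Prod.snd_add, Prod.snd_sum, Prod.smul_snd, smul_eq_mul]
    have h1 : ∑ i, v.1 i * (-(1 / 2) * q.2.1 i) = -(1 / 2) * ∑ i, q.2.1 i * v.1 i := by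
      rw [Finset.mul_sum]; exact Finset.sum_congr rfl fun i _ => by ring
    have h2 : ∑ i, v.2.1 i * (1 / 2 * q.1 i) = 1 / 2 * ∑ i, q.1 i * v.2.1 i := by
      rw [Finset.mul_sum]; exact Finset.sum_congr rfl fun i _ => by ring
    rw [h1, h2]
    linarith

theorem tangentNorm_sq_of_mem {q v : Space n} (hv : v ∈ distribution q) :
    tangentNorm q v ^ 2 = ∑ i, v.1 i ^ 2 + ∑ i, v.2.1 i ^ 2 := by
  have h : contactForm q v = 0 := hv
  have e : metric q v v = ∑ i, v.1 i ^ 2 + ∑ i, v.2.1 i ^ 2 := by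
    simp [metric, h, sq]
  rw [tangentNorm, Real.sq_sqrt (by rw [e]; positivity), e]

theorem hamiltonian_eq (ξ : Cotangent n) : hamiltonian ξ =
    1 / 2 * (∑ i, ξ.2 (frameX i ξ.1) ^ 2 + ∑ i, ξ.2 (frameY i ξ.1) ^ 2) := by
  obtain ⟨q, p⟩ := ξ
  have key : ∀ v ∈ distribution q, p v - 1 / 2 * tangentNorm q v ^ 2 =
      1 / 2 * (∑ i, p (frameX i q) ^ 2 + ∑ i, p (frameY i q) ^ 2) -
      1 / 2 * (∑ i, (p (frameX i q) - v.1 i) ^ 2 + ∑ i, (p (frameY i q) - v.2.1 i) ^ 2) := by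
    intro v hv
    have e : p v = ∑ i, v.1 i * p (frameX i q) + ∑ i, v.2.1 i * p (frameY i q) := by
      conv_lhs => rw [eq_sum_of_mem_distribution hv]
      simp
    rw [e, tangentNorm_sq_of_mem hv]
    simp only [Finset.mul_sum, mul_add, ← Finset.sum_add_distrib, ← Finset.sum_sub_distrib]
    exact Finset.sum_congr rfl fun i _ => by ring
  set u : Space n := ∑ i, p (frameX i q) • frameX i q + ∑ i, p (frameY i q) • frameY i q with hu
  have hmem : u ∈ distribution q := by
    simp [hu, distribution, contactForm_frameX, contactForm_frameY]
  have hu1 : u.1 = fun i => p (frameX i q) := by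
    funext j
    simp [hu, frameX, frameY, Prod.fst_sum, Finset.sum_apply, Pi.single_apply]
  have hu2 : u.2.1 = fun i => p (frameY i q) := by
    funext j
    simp [hu, frameX, frameY, Prod.fst_sum, Prod.snd_sum, Finset.sum_apply, Pi.single_apply]
  have hle : ∀ v : distribution q, p v - 1 / 2 * tangentNorm q v ^ 2 ≤
      1 / 2 * (∑ i, p (frameX i q) ^ 2 + ∑ i, p (frameY i q) ^ 2) := fun v => by
    rw [key v v.2]
    have : 0 ≤ ∑ i, (p (frameX i q) - v.1.1 i) ^ 2 + ∑ i, (p (frameY i q) - v.1.2.1 i) ^ 2 := by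
      positivity
    linarith
  refine le_antisymm (ciSup_le hle) ?_
  refine le_trans (le_of_eq ?_) (le_ciSup ⟨_, forall_mem_range.2 hle⟩ ⟨u, hmem⟩)
  rw [key u hmem, hu1, hu2]
  simp

theorem hasFDerivAt_hamiltonian (ξ : Cotangent n) :
    DifferentiableAt ℝ hamiltonian ξ ∧ ∀ w : Cotangent n, fderiv ℝ hamiltonian ξ w =
      ∑ i, ξ.2 (frameX i ξ.1) * (w.2 (frameX i ξ.1) - 1 / 2 * w.1.2.1 i * ξ.2 (0, 0, 1)) +
      ∑ i, ξ.2 (frameY i ξ.1) * (w.2 (frameY i ξ.1) + 1 / 2 * w.1.1 i * ξ.2 (0, 0, 1)) := by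
  have lin : ∀ (c : ℝ) (v : Space n) (L : Space n →L[ℝ] ℝ),
      L (v.1, v.2.1, c) = L (v.1, v.2.1, 0) + c * L (0, 0, 1) := fun c v L => by
    rw [← smul_eq_mul, ← map_smul, ← map_add]; simp
  have hX : ∀ (i : Fin n) (η : Cotangent n), η.2 (frameX i η.1) =
      η.2 (Pi.single i 1, 0, 0) + -(1 / 2) * η.1.2.1 i * η.2 (0, 0, 1) := fun i η =>
    lin _ (Pi.single i 1, 0, 0) _
  have hY : ∀ (i : Fin n) (η : Cotangent n), η.2 (frameY i η.1) =
      η.2 (0, Pi.single i 1, 0) + 1 / 2 * η.1.1 i * η.2 (0, 0, 1) := fun i η =>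
    lin _ (0, Pi.single i 1, 0) _
  have ev : ∀ v : Space n, HasFDerivAt (fun η : Cotangent n => η.2 v)
      ((ContinuousLinearMap.apply ℝ ℝ v).comp (ContinuousLinearMap.snd ℝ (Space n) _)) ξ := fun v =>
    ((ContinuousLinearMap.apply ℝ ℝ v).comp
      (ContinuousLinearMap.snd ℝ (Space n) (Space n →L[ℝ] ℝ))).hasFDerivAt
  have cx : ∀ i : Fin n, HasFDerivAt (fun η : Cotangent n => η.1.1 i)
      (((ContinuousLinearMap.proj (R := ℝ) (φ := fun _ : Fin n => ℝ) i).comp (ContinuousLinearMap.fst ℝ (Fin n → ℝ) _)).comp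
        (ContinuousLinearMap.fst ℝ (Space n) _)) ξ := fun i =>
    (((ContinuousLinearMap.proj (R := ℝ) (φ := fun _ : Fin n => ℝ) i).comp (ContinuousLinearMap.fst ℝ (Fin n → ℝ) _)).comp
        (ContinuousLinearMap.fst ℝ (Space n) (Space n →L[ℝ] ℝ))).hasFDerivAt
  have cy : ∀ i : Fin n, HasFDerivAt (fun η : Cotangent n => η.1.2.1 i)
      ((((ContinuousLinearMap.proj (R := ℝ) (φ := fun _ : Fin n => ℝ) i).comp (ContinuousLinearMap.fst ℝ (Fin n → ℝ) ℝ)).comp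
        (ContinuousLinearMap.snd ℝ (Fin n → ℝ) _)).comp
        (ContinuousLinearMap.fst ℝ (Space n) _)) ξ := fun i =>
    ((((ContinuousLinearMap.proj (R := ℝ) (φ := fun _ : Fin n => ℝ) i).comp (ContinuousLinearMap.fst ℝ (Fin n → ℝ) ℝ)).comp
        (ContinuousLinearMap.snd ℝ (Fin n → ℝ) _)).comp
        (ContinuousLinearMap.fst ℝ (Space n) (Space n →L[ℝ] ℝ))).hasFDerivAt
  have e : (hamiltonian : Cotangent n → ℝ) = fun η =>
      1 / 2 * (∑ i, (η.2 (Pi.single i 1, 0, 0) + -(1 / 2) * η.1.2.1 i * η.2 (0, 0, 1)) ^ 2 +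
        ∑ i, (η.2 (0, Pi.single i 1, 0) + 1 / 2 * η.1.1 i * η.2 (0, 0, 1)) ^ 2) := by
    funext η
    rw [hamiltonian_eq]
    simp only [hX, hY]
  have tX := fun i : Fin n => ((ev (Pi.single i 1, 0, 0)).add
    (((cy i).const_mul (-(1 / 2))).mul (ev (0, 0, 1)))).pow 2
  have tY := fun i : Fin n => ((ev (0, Pi.single i 1, 0)).add
    (((cx i).const_mul (1 / 2)).mul (ev (0, 0, 1)))).pow 2
  have D := ((HasFDerivAt.fun_sum (u := Finset.univ) fun i _ => tX i).add
    (HasFDerivAt.fun_sum (u := Finset.univ) fun i _ => tY i)).const_mul (1 / 2)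
  have D' := D.congr_of_eventuallyEq (f₁ := hamiltonian)
    (Filter.Eventually.of_forall fun η => by rw [e]; rfl)
  refine ⟨D'.differentiableAt, fun w => ?_⟩
  rw [D'.fderiv]
  have hX' : ∀ i, w.2 (frameX i ξ.1) =
      w.2 (Pi.single i 1, 0, 0) + -(1 / 2) * ξ.1.2.1 i * w.2 (0, 0, 1) := fun i => hX i (ξ.1, w.2)
  have hY' : ∀ i, w.2 (frameY i ξ.1) =
      w.2 (0, Pi.single i 1, 0) + 1 / 2 * ξ.1.1 i * w.2 (0, 0, 1) := fun i => hY i (ξ.1, w.2)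
  simp only [hX, hY, hX', hY']
  simp only [smul_apply, add_apply, sum_apply]
  rw [smul_add, Finset.smul_sum, Finset.smul_sum]
  refine congrArg₂ _ (Finset.sum_congr rfl fun i _ => ?_) (Finset.sum_congr rfl fun i _ => ?_)
  · simp
    ring
  · simp
    ring

/-- The Hamiltonian vector field is complete. -/
theorem exists_isTrajectory (ξ : Cotangent n) : ∃ γ, IsTrajectory ξ γ := by
  obtain ⟨q, p⟩ := ξ
  set ζ := p (0, 0, 1) with hζ
  set u : Fin n → ℝ → ℝ := fun i t =>
    p (frameX i q) * Real.cos (t * ζ) - p (frameY i q) * Real.sin (t * ζ) with hu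
  set v : Fin n → ℝ → ℝ := fun i t =>
    p (frameY i q) * Real.cos (t * ζ) + p (frameX i q) * Real.sin (t * ζ) with hv
  have du : ∀ i t, HasDerivAt (u i) (-(v i t * ζ)) t := fun i t => by
    have h := (hasDerivAt_id t).mul_const ζ
    refine (((h.cos).const_mul (p (frameX i q))).sub
      ((h.sin).const_mul (p (frameY i q)))).congr_deriv ?_
    simp [hv]; ring
  have dv : ∀ i t, HasDerivAt (v i) (u i t * ζ) t := fun i t => by
    have h := (hasDerivAt_id t).mul_const ζ
    refine (((h.cos).const_mul (p (frameY i q))).add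
      ((h.sin).const_mul (p (frameX i q)))).congr_deriv ?_
    simp [hu]; ring
  have cu : ∀ i, Continuous (u i) := fun i => by fun_prop
  have cv : ∀ i, Continuous (v i) := fun i => by fun_prop
  set x : Fin n → ℝ → ℝ := fun i t => q.1 i + ∫ s in (0 : ℝ)..t, u i s with hx
  set y : Fin n → ℝ → ℝ := fun i t => q.2.1 i + ∫ s in (0 : ℝ)..t, v i s with hy
  have dx : ∀ i t, HasDerivAt (x i) (u i t) t := fun i t =>
    ((cu i).integral_hasStrictDerivAt 0 t).hasDerivAt.const_add _
  have dy : ∀ i t, HasDerivAt (y i) (v i t) t := fun i t =>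
    ((cv i).integral_hasStrictDerivAt 0 t).hasDerivAt.const_add _
  have cx : ∀ i, Continuous (x i) := fun i =>
    continuous_iff_continuousAt.2 fun t => (dx i t).continuousAt
  have cy : ∀ i, Continuous (y i) := fun i =>
    continuous_iff_continuousAt.2 fun t => (dy i t).continuousAt
  set f : ℝ → ℝ := fun t =>
    ∑ i, u i t * (-(1 / 2) * y i t) + ∑ i, v i t * (1 / 2 * x i t) with hf
  have cf : Continuous f := by fun_prop
  set z : ℝ → ℝ := fun t => q.2.2 + ∫ s in (0 : ℝ)..t, f s with hz
  have dz : ∀ t, HasDerivAt z (f t) t := fun t =>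
    (cf.integral_hasStrictDerivAt 0 t).hasDerivAt.const_add _
  set A : Fin n → Space n →L[ℝ] ℝ := fun i =>
    (ContinuousLinearMap.proj (R := ℝ) (φ := fun _ : Fin n => ℝ) i).comp
      (ContinuousLinearMap.fst ℝ (Fin n → ℝ) ((Fin n → ℝ) × ℝ)) with hA
  set B : Fin n → Space n →L[ℝ] ℝ := fun i =>
    ((ContinuousLinearMap.proj (R := ℝ) (φ := fun _ : Fin n => ℝ) i).comp
      (ContinuousLinearMap.fst ℝ (Fin n → ℝ) ℝ)).comp
      (ContinuousLinearMap.snd ℝ (Fin n → ℝ) ((Fin n → ℝ) × ℝ)) with hB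
  set C : Space n →L[ℝ] ℝ := (ContinuousLinearMap.snd ℝ (Fin n → ℝ) ℝ).comp
      (ContinuousLinearMap.snd ℝ (Fin n → ℝ) ((Fin n → ℝ) × ℝ)) with hC
  set P : ℝ → Space n →L[ℝ] ℝ := fun t =>
    ∑ i, (u i t + 1 / 2 * y i t * ζ) • A i + ∑ i, (v i t - 1 / 2 * x i t * ζ) • B i + ζ • C with hP
  have dP : ∀ t, HasDerivAt P
      (∑ i, (-(v i t * ζ) + 1 / 2 * v i t * ζ) • A i +
        ∑ i, (u i t * ζ - 1 / 2 * u i t * ζ) • B i) t := fun t => by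
    refine HasDerivAt.add_const _ (HasDerivAt.add ?_ ?_)
    · exact HasDerivAt.fun_sum fun i _ =>
        ((du i t).fun_add (((dy i t).const_mul (1 / 2)).mul_const ζ)).smul_const (A i)
    · exact HasDerivAt.fun_sum fun i _ =>
        ((dv i t).fun_sub (((dx i t).const_mul (1 / 2)).mul_const ζ)).smul_const (B i)
  refine ⟨fun t => ((fun i => x i t, fun i => y i t, z t), P t), ?_, fun t => ?_⟩
  · have hx0 : ∀ i, x i 0 = q.1 i := fun i => by simp [hx]
    have hy0 : ∀ i, y i 0 = q.2.1 i := fun i => by simp [hy]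
    have hz0 : z 0 = q.2.2 := by simp [hz]
    have lX : ∀ i, p (frameX i q) + 1 / 2 * q.2.1 i * ζ = p (Pi.single i 1, 0, 0) := fun i => by
      rw [hζ, ← smul_eq_mul, ← map_smul, ← map_add]
      simp [frameX]
    have lY : ∀ i, p (frameY i q) - 1 / 2 * q.1 i * ζ = p (0, Pi.single i 1, 0) := fun i => by
      rw [hζ, ← smul_eq_mul, ← map_smul, ← map_sub]
      simp [frameY]
    have hP0 : P 0 = p := by
      refine ContinuousLinearMap.ext fun w => ?_
      have ew : w = ∑ i, w.1 i • ((Pi.single i 1, 0, 0) : Space n) +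
          ∑ i, w.2.1 i • ((0, Pi.single i 1, 0) : Space n) + w.2.2 • ((0, 0, 1) : Space n) := by
        refine Prod.ext ?_ (Prod.ext ?_ ?_)
        · funext j
          simp [Prod.fst_sum, Finset.sum_apply, Pi.single_apply]
        · funext j
          simp [Prod.fst_sum, Prod.snd_sum, Finset.sum_apply, Pi.single_apply]
        · simp [Prod.snd_sum]
      conv_rhs => rw [ew]
      simp only [hP, hx0, hy0, hu, hv, zero_mul, Real.cos_zero, Real.sin_zero, mul_one, mul_zero,
        sub_zero, add_zero, lX, lY]
      simp only [map_add, map_sum, map_smul, smul_eq_mul, add_apply, sum_apply, smul_apply, hA, hB,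
        hC, ContinuousLinearMap.comp_apply, ContinuousLinearMap.proj_apply,
        ContinuousLinearMap.coe_fst', ContinuousLinearMap.coe_snd', mul_comm, ← hζ]
    simp only [hP0, hx0, hy0, hz0]
  · refine ⟨((fun i => u i t, fun i => v i t, f t), _), ?_,
      HasDerivAt.prodMk (HasDerivAt.prodMk (hasDerivAt_pi.2 fun i => dx i t)
        (HasDerivAt.prodMk (hasDerivAt_pi.2 fun i => dy i t) (dz t))) (dP t)⟩
    intro w
    rw [(hasFDerivAt_hamiltonian _).2]
    have pz : P t (0, 0, 1) = ζ := by simp [hP, hA, hB, hC]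
    have pX : ∀ i, P t (frameX i (fun i => x i t, fun i => y i t, z t)) = u i t := fun i => by
      simp [hP, hA, hB, hC, frameX, sum_apply, Pi.single_apply]
      ring
    have pY : ∀ i, P t (frameY i (fun i => x i t, fun i => y i t, z t)) = v i t := fun i => by
      simp [hP, hA, hB, hC, frameY, sum_apply, Pi.single_apply]
      ring
    simp only [pz, pX, pY]
    have ev : ((fun i => u i t, fun i => v i t, f t) : Space n) =
        ∑ i, u i t • frameX i (fun i => x i t, fun i => y i t, z t) +
        ∑ i, v i t • frameY i (fun i => x i t, fun i => y i t, z t) := by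
      refine Prod.ext ?_ (Prod.ext ?_ ?_)
      · funext j
        simp [frameX, frameY, Prod.fst_sum, Finset.sum_apply, Pi.single_apply]
      · funext j
        simp [frameX, frameY, Prod.fst_sum, Prod.snd_sum, Finset.sum_apply, Pi.single_apply]
      · simp [frameX, frameY, Prod.snd_sum, hf]
    simp only [symplecticForm]
    rw [ev]
    simp only [map_add, map_sum, map_smul, smul_eq_mul, add_apply, sum_apply, smul_apply, hA, hB,
      ContinuousLinearMap.comp_apply, ContinuousLinearMap.proj_apply,
      ContinuousLinearMap.coe_fst', ContinuousLinearMap.coe_snd']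
    rw [← Finset.sum_add_distrib, ← Finset.sum_add_distrib, ← Finset.sum_add_distrib,
      ← Finset.sum_sub_distrib, ← Finset.sum_neg_distrib]
    exact Finset.sum_congr rfl fun i _ => by ring

/-- The Hamiltonian flow `e^{tH}` on the cotangent bundle: `geodesicFlow t ξ` is the position at
time `t` of the integral curve of the Hamiltonian vector field that starts at `ξ`. -/
def geodesicFlow (t : ℝ) (ξ : Cotangent n) : Cotangent n :=
  Classical.choose (exists_isTrajectory ξ) t

/-- The map `ψ_t(q, p) = π(e^{tH}(q, p))`, where `π` is the projection to the base. -/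
def psi (t : ℝ) (q : Space n) (p : Space n →L[ℝ] ℝ) : Space n := (geodesicFlow t (q, p)).1

/-! ### Conjugate times -/

/-- The times `t > 0` at which the differential at `p` of `ψ_t : T*_q M → M` is not bijective. -/
def conjugateTimes (q : Space n) (p : Space n →L[ℝ] ℝ) : Set ℝ :=
  {t | 0 < t ∧ ¬ Function.Bijective (fderiv ℝ (fun p' => psi t q p') p)}

/-- The first conjugate time, `∞` if there is no conjugate time. -/
def firstConjugateTime (q : Space n) (p : Space n →L[ℝ] ℝ) : ℝ≥0∞ :=
  ⨅ t ∈ conjugateTimes q p, ENNReal.ofReal t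

/-! ### Cut times -/

/-- `γ` restricted to `[a, b]` is a horizontal curve: absolutely continuous, and tangent to the
distribution almost everywhere. -/
def IsHorizontalCurve (γ : ℝ → Space n) (a b : ℝ) : Prop :=
  AbsolutelyContinuousOnInterval γ a b ∧
    ∀ᵐ t : ℝ, t ∈ Icc a b → DifferentiableAt ℝ γ t ∧ deriv γ t ∈ distribution (γ t)

/-- The sub-Riemannian length of `γ` on `[a, b]`. -/
def curveLength (γ : ℝ → Space n) (a b : ℝ) : ℝ := ∫ t in a..b, tangentNorm (γ t) (deriv γ t)

/-- `γ` restricted to `[a, b]` is length minimizing between its endpoints. -/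
def IsLengthMinimizing (γ : ℝ → Space n) (a b : ℝ) : Prop :=
  IsHorizontalCurve γ a b ∧ ∀ (c : ℝ → Space n) (a' b' : ℝ), a' ≤ b' → IsHorizontalCurve c a' b' →
    c a' = γ a → c b' = γ b → curveLength γ a b ≤ curveLength c a' b'

/-- The times `T > 0` such that `[0, T] ∋ t ↦ ψ_t(q, p)` is length minimizing. -/
def minimizingTimes (q : Space n) (p : Space n →L[ℝ] ℝ) : Set ℝ :=
  {T | 0 < T ∧ IsLengthMinimizing (fun t => psi t q p) 0 T}

/-- The cut time, `∞` if the geodesic is length minimizing on arbitrarily long intervals. -/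
def cutTime (q : Space n) (p : Space n →L[ℝ] ℝ) : ℝ≥0∞ :=
  ⨆ T ∈ minimizingTimes q p, ENNReal.ofReal T

end Heisenberg

end

/-!
Write `ζ = p(∂_z)`, `aᵢ = p(Xᵢ)`, `bᵢ = p(Yᵢ)`. Along the Hamiltonian flow `ζ` is constant and
the `(aᵢ, bᵢ)` rotate with angular velocity `ζ`. So, after a left translation of the starting point
to the origin, the projection of the geodesic to each `(xᵢ, yᵢ)` plane is an arc of a circle of
angle `ζ t` (a segment if `ζ = 0`), and `z` is the area swept out (`psi_fst`, `psi_snd_fst`,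
`vert_psi`). Both the cut time and the first conjugate time are `2π / |ζ|`, which is infinite for
`ζ = 0`.

*Minimality up to `2π / |ζ|`* is proved by a calibration. For fixed `ζ`, the function
`W = ζ z + (ζ / 4) cot (ζ t / 2) (|x|² + |y|²)` solves the Hamilton-Jacobi equation
`∂W/∂t + |∇W|² / 2 = 0`, where `∇` is the horizontal gradient. With `t` the arclength of a
horizontal curve, `W` therefore grows at a rate at most `|∇W| - |∇W|² / 2 ≤ 1 / 2` per unit of
length, with equality along the geodesic. Integrating over the curve
(`IsHorizontalCurve.calibration`), which is the fundamental theorem of calculus for absolutely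
continuous functions, bounds the length of any competitor from below by the length of the geodesic
(`isLengthMinimizing_psi`). For `ζ = 0` a linear function calibrates.

*Past `2π / |ζ|`* the arc wraps around its circle more than once. Its chord with a single circle
superposed, of the radius that gives the right area, is shorter (`exists_chord_add_circle`,
`not_isLengthMinimizing_psi`).

*Conjugate times.* A covector in the kernel of the differential leaves the ratio of swept area to
squared chord stationary. That ratio is a function of the angle alone with nonzero derivative on
`(-2π, 2π)` (`two_sub_two_mul_cos_sub_pos`), which leaves only the zero covector
(`bijective_fderiv_psi`). At angle `±2π` the chord vanishes and the differential is degenerate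
(`not_bijective_fderiv_psi`).
-/

noncomputable section

namespace Heisenberg

variable {n : ℕ}

/-! ### Primitives of `cos (ζ t)` and `sin (ζ t)` -/

/-- The primitive `∫₀ᵗ cos (ζ s) ds`. -/
def sinInt (ζ t : ℝ) : ℝ := if ζ = 0 then t else Real.sin (ζ * t) / ζ

/-- The primitive `∫₀ᵗ sin (ζ s) ds`. At `ζ = 0` the convention `x / 0 = 0` gives its true value. -/
def cosInt (ζ t : ℝ) : ℝ := (1 - Real.cos (ζ * t)) / ζ

/-- The primitive `∫₀ᵗ cosInt ζ s ds`, twice the area enclosed by the arc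
`s ↦ (sinInt ζ s, cosInt ζ s)`, `s ≤ t`, and its chord. At `ζ = 0` the convention `x / 0 = 0` gives
its true value. -/
def areaInt (ζ t : ℝ) : ℝ := (t - sinInt ζ t) / ζ

theorem sinInt_of_ne {ζ : ℝ} (h : ζ ≠ 0) (t : ℝ) : sinInt ζ t = Real.sin (ζ * t) / ζ := if_neg h

@[simp] theorem sinInt_zero_left (t : ℝ) : sinInt 0 t = t := if_pos rfl

@[simp] theorem cosInt_zero_left (t : ℝ) : cosInt 0 t = 0 := by simp [cosInt]

@[simp] theorem areaInt_zero_left (t : ℝ) : areaInt 0 t = 0 := by simp [areaInt]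

@[simp] theorem sinInt_zero_right (ζ : ℝ) : sinInt ζ 0 = 0 := by simp [sinInt]

@[simp] theorem cosInt_zero_right (ζ : ℝ) : cosInt ζ 0 = 0 := by simp [cosInt]

@[simp] theorem areaInt_zero_right (ζ : ℝ) : areaInt ζ 0 = 0 := by simp [areaInt]

theorem hasDerivAt_sinInt (ζ t : ℝ) : HasDerivAt (sinInt ζ) (Real.cos (ζ * t)) t := by
  rcases eq_or_ne ζ 0 with rfl | h
  · have : sinInt 0 = id := funext fun s => by simp
    rw [this]; simpa using hasDerivAt_id t
  · have : sinInt ζ = fun s => Real.sin (ζ * s) / ζ := funext fun s => sinInt_of_ne h s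
    rw [this]
    refine ((((hasDerivAt_id t).const_mul ζ).sin).div_const ζ).congr_deriv ?_
    simp only [id]; field_simp

theorem hasDerivAt_cosInt (ζ t : ℝ) : HasDerivAt (cosInt ζ) (Real.sin (ζ * t)) t := by
  refine (((((hasDerivAt_id t).const_mul ζ).cos).const_sub 1).div_const ζ).congr_deriv ?_
  rcases eq_or_ne ζ 0 with rfl | h
  · simp
  · simp only [id]; field_simp

theorem hasDerivAt_areaInt (ζ t : ℝ) : HasDerivAt (areaInt ζ) (cosInt ζ t) t :=
  ((hasDerivAt_id t).sub (hasDerivAt_sinInt ζ t)).div_const ζ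

theorem sinInt_mul_sin_sub (ζ t : ℝ) :
    sinInt ζ t * Real.sin (ζ * t) - cosInt ζ t * Real.cos (ζ * t) = cosInt ζ t := by
  rcases eq_or_ne ζ 0 with rfl | h
  · simp
  · rw [sinInt_of_ne h, cosInt]
    field_simp
    linear_combination Real.sin_sq_add_cos_sq (ζ * t)

theorem sinInt_sq_add_cosInt_sq {ζ : ℝ} (h : ζ ≠ 0) (t : ℝ) :
    sinInt ζ t ^ 2 + cosInt ζ t ^ 2 = 2 * (1 - Real.cos (ζ * t)) / ζ ^ 2 := by
  rw [sinInt_of_ne h, cosInt]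
  field_simp
  linear_combination Real.sin_sq_add_cos_sq (ζ * t)

theorem hasDerivAt_sinInt_left {ζ : ℝ} (h : ζ ≠ 0) (t : ℝ) : HasDerivAt (fun ζ => sinInt ζ t)
    ((t * Real.cos (ζ * t) - sinInt ζ t) / ζ) ζ := by
  have e : (fun ζ => sinInt ζ t) =ᶠ[nhds ζ] fun ζ => Real.sin (ζ * t) / ζ := by
    filter_upwards [isOpen_ne.mem_nhds h] with x hx using sinInt_of_ne hx t
  refine HasDerivAt.congr_of_eventuallyEq ?_ e
  refine ((((hasDerivAt_id ζ).mul_const t).sin).div (hasDerivAt_id ζ) h).congr_deriv ?_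
  rw [sinInt_of_ne h]
  simp only [id]; field_simp

theorem hasDerivAt_cosInt_left {ζ : ℝ} (h : ζ ≠ 0) (t : ℝ) : HasDerivAt (fun ζ => cosInt ζ t)
    ((t * Real.sin (ζ * t) - cosInt ζ t) / ζ) ζ := by
  refine (((((hasDerivAt_id ζ).mul_const t).cos).const_sub 1).div
    (hasDerivAt_id ζ) h).congr_deriv ?_
  rw [cosInt]
  simp only [id]; field_simp

theorem hasDerivAt_areaInt_left {ζ : ℝ} (h : ζ ≠ 0) (t : ℝ) : HasDerivAt (fun ζ => areaInt ζ t)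
    ((sinInt ζ t - t * Real.cos (ζ * t)) / ζ ^ 2 - areaInt ζ t / ζ) ζ := by
  refine (((hasDerivAt_sinInt_left h t).const_sub t).div (hasDerivAt_id ζ) h).congr_deriv ?_
  rw [areaInt]
  simp only [id]; field_simp; ring

/-- A quadratic bound on the remainder of a first-order expansion gives the derivative. -/
theorem hasDerivAt_zero_of_abs_sub_le {f : ℝ → ℝ} {f' C δ : ℝ} (hδ : 0 < δ)
    (h : ∀ x, |x| ≤ δ → |f x - f 0 - x * f'| ≤ C * x ^ 2) : HasDerivAt f f' 0 := by
  rw [hasDerivAt_iff_isLittleO]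
  have h1 : (fun x => f x - f 0 - (x - 0) • f') =O[nhds 0] fun x : ℝ => x ^ 2 := by
    refine Asymptotics.IsBigO.of_bound C ?_
    filter_upwards [Metric.closedBall_mem_nhds (0 : ℝ) hδ] with x hx
    have hx' : |x| ≤ δ := by simpa [Real.dist_eq] using hx
    simpa [Real.norm_eq_abs] using h x hx'
  refine h1.trans_isLittleO ?_
  simpa using Asymptotics.isLittleO_pow_id (𝕜 := ℝ) (n := 2) (by norm_num)

theorem hasDerivAt_sinInt_left_zero {t : ℝ} (ht : 0 < t) :
    HasDerivAt (fun ζ => sinInt ζ t) 0 0 := by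
  refine hasDerivAt_zero_of_abs_sub_le (C := t ^ 3) (δ := 1 / t) (by positivity) fun x hx => ?_
  rcases eq_or_ne x 0 with rfl | h0
  · simp
  have hxt : |x * t| ≤ 1 := by
    rw [abs_mul, abs_of_pos ht]; rwa [le_div_iff₀ ht] at hx
  have := Real.sin_bound hxt
  rw [sinInt_of_ne h0, sinInt_zero_left, mul_zero, sub_zero]
  have e : Real.sin (x * t) / x - t = (Real.sin (x * t) - x * t) / x := by field_simp
  rw [e, abs_div, div_le_iff₀ (abs_pos.2 h0)]
  have h5 : |x * t| ^ 5 ≤ |x * t| ^ 3 :=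
    pow_le_pow_of_le_one (abs_nonneg _) hxt (by norm_num)
  have h3 : |(x * t) ^ 3 / 6| = |x * t| ^ 3 / 6 := by
    rw [abs_div, abs_pow]; norm_num
  have e2 : t ^ 3 * x ^ 2 * |x| = |x * t| ^ 3 := by
    rw [abs_mul, abs_of_pos ht, ← sq_abs x]; ring
  rw [e2]
  have := abs_sub_abs_le_abs_sub (Real.sin (x * t) - x * t) (-((x * t) ^ 3 / 6))
  rw [abs_neg, h3] at this
  have e3 : Real.sin (x * t) - x * t - -((x * t) ^ 3 / 6)
    = Real.sin (x * t) - (x * t - (x * t) ^ 3 / 6) := by ring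
  rw [e3] at this
  have : 0 ≤ |x * t| ^ 3 := by positivity
  linarith

theorem hasDerivAt_cosInt_left_zero {t : ℝ} (ht : 0 < t) :
    HasDerivAt (fun ζ => cosInt ζ t) (t ^ 2 / 2) 0 := by
  refine hasDerivAt_zero_of_abs_sub_le (C := t ^ 3) (δ := 1 / t) (by positivity) fun x hx => ?_
  rcases eq_or_ne x 0 with rfl | h0
  · simp
  have hxt : |x * t| ≤ 1 := by
    rw [abs_mul, abs_of_pos ht]; rwa [le_div_iff₀ ht] at hx
  have hb := Real.cos_bound hxt
  rw [cosInt_zero_left, sub_zero, cosInt]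
  have e : (1 - Real.cos (x * t)) / x - x * (t ^ 2 / 2) =
      -(Real.cos (x * t) - (1 - (x * t) ^ 2 / 2)) / x := by field_simp; ring
  rw [e, abs_div, abs_neg, div_le_iff₀ (abs_pos.2 h0)]
  have h5 : |x * t| ^ 4 ≤ |x * t| ^ 3 :=
    pow_le_pow_of_le_one (abs_nonneg _) hxt (by norm_num)
  have e2 : t ^ 3 * x ^ 2 * |x| = |x * t| ^ 3 := by
    rw [abs_mul, abs_of_pos ht, ← sq_abs x]; ring
  rw [e2]
  have : 0 ≤ |x * t| ^ 3 := by positivity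
  linarith

theorem hasDerivAt_areaInt_left_zero {t : ℝ} (ht : 0 < t) :
    HasDerivAt (fun ζ => areaInt ζ t) (t ^ 3 / 6) 0 := by
  refine hasDerivAt_zero_of_abs_sub_le (C := t ^ 4) (δ := 1 / t) (by positivity) fun x hx => ?_
  rcases eq_or_ne x 0 with rfl | h0
  · simp
  have hxt : |x * t| ≤ 1 := by
    rw [abs_mul, abs_of_pos ht]; rwa [le_div_iff₀ ht] at hx
  have hb := Real.sin_bound hxt
  rw [areaInt_zero_left, sub_zero, areaInt, sinInt_of_ne h0]
  have e : (t - Real.sin (x * t) / x) / x - x * (t ^ 3 / 6) =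
      -(Real.sin (x * t) - (x * t - (x * t) ^ 3 / 6)) / x ^ 2 := by field_simp; ring
  rw [e, abs_div, abs_neg, div_le_iff₀ (by positivity), abs_of_nonneg (sq_nonneg x)]
  have h5 : |x * t| ^ 5 ≤ |x * t| ^ 4 :=
    pow_le_pow_of_le_one (abs_nonneg _) hxt (by norm_num)
  have e2 : t ^ 4 * x ^ 2 * x ^ 2 = |x * t| ^ 4 := by
    rw [abs_mul, abs_of_pos ht, ← sq_abs x]; ring
  rw [e2]
  have : 0 ≤ |x * t| ^ 4 := by positivity
  linarith

/-! ### The trajectories of the Hamiltonian vector field -/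

/-- Hamilton's equations: the velocity has the frame components `p(Xᵢ)`, `p(Yᵢ)`. -/
theorem hamiltonianVector_eq {ξ v : Cotangent n} (h : IsHamiltonianVector ξ v) :
    v.1 = ∑ i, ξ.2 (frameX i ξ.1) • frameX i ξ.1 + ∑ i, ξ.2 (frameY i ξ.1) • frameY i ξ.1 ∧
    ∀ w : Space n, v.2 w = ∑ i, ξ.2 (frameX i ξ.1) * (1 / 2 * w.2.1 i * ξ.2 (0, 0, 1)) -
      ∑ i, ξ.2 (frameY i ξ.1) * (1 / 2 * w.1 i * ξ.2 (0, 0, 1)) := by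
  constructor
  · refine (SeparatingDual.eq_iff_forall_dual_eq (R := ℝ)).2 fun L => ?_
    have := h (0, L)
    rw [(hasFDerivAt_hamiltonian ξ).2] at this
    simp only [symplecticForm, map_zero, zero_sub, Prod.fst_zero, Prod.snd_zero,
      Pi.zero_apply, mul_zero, zero_mul, sub_zero, add_zero, neg_inj] at this
    simp only [this, map_add, map_sum, map_smul, smul_eq_mul]
  · intro w
    have := h (w, 0)
    rw [(hasFDerivAt_hamiltonian ξ).2] at this
    simp only [symplecticForm, zero_apply, sub_zero, zero_sub, zero_add, mul_neg,
      Finset.sum_neg_distrib] at this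
    rw [this]; ring

theorem apply_frameX (p : Space n →L[ℝ] ℝ) (i : Fin n) (q : Space n) :
    p (frameX i q) = p (Pi.single i 1, 0, 0) - 1 / 2 * q.2.1 i * p (0, 0, 1) := by
  have : frameX i q = (Pi.single i 1, 0, 0) - (1 / 2 * q.2.1 i) • (0, 0, 1) := by
    simp [frameX]
  rw [this, map_sub, map_smul, smul_eq_mul]

theorem apply_frameY (p : Space n →L[ℝ] ℝ) (i : Fin n) (q : Space n) :
    p (frameY i q) = p (0, Pi.single i 1, 0) + 1 / 2 * q.1 i * p (0, 0, 1) := by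
  have : frameY i q = (0, Pi.single i 1, 0) + (1 / 2 * q.1 i) • (0, 0, 1) := by
    simp [frameY]
  rw [this, map_add, map_smul, smul_eq_mul]

theorem eq_apply_zero_of_hasDerivAt_zero {f : ℝ → ℝ} (h : ∀ t, HasDerivAt f 0 t) (t : ℝ) :
    f t = f 0 :=
  is_const_of_deriv_eq_zero (fun t => (h t).differentiableAt) (fun t => (h t).deriv) t 0

theorem eq_of_hasDerivAt_eq {f g f' : ℝ → ℝ} (hf : ∀ t, HasDerivAt f (f' t) t)
    (hg : ∀ t, HasDerivAt g (f' t) t) (h0 : f 0 = g 0) (t : ℝ) : f t = g t := by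
  have := eq_apply_zero_of_hasDerivAt_zero (f := fun t => f t - g t)
    (fun t => ((hf t).fun_sub (hg t)).congr_deriv (sub_self _)) t
  simp only [h0, sub_self] at this
  linarith

/-- The linear system `u' = -ζ v`, `v' = ζ u` has only the obvious solutions: rotating a solution
back by the angle `ζ t` makes it constant. -/
theorem rotation_eq {ζ : ℝ} {u v : ℝ → ℝ} (hu : ∀ t, HasDerivAt u (-(ζ * v t)) t)
    (hv : ∀ t, HasDerivAt v (ζ * u t) t) (t : ℝ) :
    u t = u 0 * Real.cos (ζ * t) - v 0 * Real.sin (ζ * t) ∧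
    v t = v 0 * Real.cos (ζ * t) + u 0 * Real.sin (ζ * t) := by
  have dc : ∀ t, HasDerivAt (fun t => Real.cos (ζ * t)) (-Real.sin (ζ * t) * ζ) t := fun t => by
    simpa using ((hasDerivAt_id t).const_mul ζ).cos
  have ds : ∀ t, HasDerivAt (fun t => Real.sin (ζ * t)) (Real.cos (ζ * t) * ζ) t := fun t => by
    simpa using ((hasDerivAt_id t).const_mul ζ).sin
  have e1 := eq_apply_zero_of_hasDerivAt_zero
    (f := fun t => u t * Real.cos (ζ * t) + v t * Real.sin (ζ * t)) (fun t =>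
    (((hu t).fun_mul (dc t)).fun_add ((hv t).fun_mul (ds t))).congr_deriv (by ring)) t
  have e2 := eq_apply_zero_of_hasDerivAt_zero
    (f := fun t => v t * Real.cos (ζ * t) - u t * Real.sin (ζ * t)) (fun t =>
    (((hv t).fun_mul (dc t)).fun_sub ((hu t).fun_mul (ds t))).congr_deriv (by ring)) t
  simp only [mul_zero, Real.cos_zero, Real.sin_zero, mul_one, add_zero, sub_zero] at e1 e2
  have h := Real.sin_sq_add_cos_sq (ζ * t)
  constructor
  · linear_combination Real.cos (ζ * t) * e1 - Real.sin (ζ * t) * e2 - u t * h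
  · linear_combination Real.cos (ζ * t) * e2 + Real.sin (ζ * t) * e1 - v t * h

/-- The `Xᵢ` component at time `t` of the velocity of the geodesic that starts at `q` with the
covector `p`. -/
def velX (p : Space n →L[ℝ] ℝ) (q : Space n) (t : ℝ) (i : Fin n) : ℝ :=
  p (frameX i q) * Real.cos (p (0, 0, 1) * t) - p (frameY i q) * Real.sin (p (0, 0, 1) * t)

/-- The `Yᵢ` component at time `t` of the velocity of the geodesic that starts at `q` with the
covector `p`. -/
def velY (p : Space n →L[ℝ] ℝ) (q : Space n) (t : ℝ) (i : Fin n) : ℝ :=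
  p (frameY i q) * Real.cos (p (0, 0, 1) * t) + p (frameX i q) * Real.sin (p (0, 0, 1) * t)

/-- Along any trajectory `p(∂_z)` is a first integral, and `p(Xᵢ)`, `p(Yᵢ)` rotate with angular
velocity `p(∂_z)`. This identifies the flow without a uniqueness theorem for differential
equations. -/
theorem isTrajectory_hasDerivAt {q : Space n} {p : Space n →L[ℝ] ℝ} {γ : ℝ → Cotangent n}
    (h : IsTrajectory (q, p) γ) (t : ℝ) :
    HasDerivAt (fun t => (γ t).1) (∑ i, velX p q t i • frameX i (γ t).1 +
      ∑ i, velY p q t i • frameY i (γ t).1) t := by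
  obtain ⟨h0, h1⟩ := h
  choose v hv hd using h1
  have d1 : ∀ t, HasDerivAt (fun t => (γ t).1) (v t).1 t := fun t => (hd t).fst
  have d2 : ∀ t, HasDerivAt (fun t => (γ t).2) (v t).2 t := fun t => (hd t).snd
  have dev : ∀ w t, HasDerivAt (fun t => (γ t).2 w) ((v t).2 w) t := fun w t => by
    simpa using (d2 t).clm_apply (hasDerivAt_const t w)
  have hζ : ∀ t, (γ t).2 (0, 0, 1) = p (0, 0, 1) := fun t => by
    have := eq_apply_zero_of_hasDerivAt_zero (f := fun t => (γ t).2 (0, 0, 1)) (fun t =>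
      (dev (0, 0, 1) t).congr_deriv (by rw [(hamiltonianVector_eq (hv t)).2]; simp)) t
    simpa [h0] using this
  have dx : ∀ i t, HasDerivAt (fun t => (γ t).1.1 i) ((γ t).2 (frameX i (γ t).1)) t := fun i t => by
    refine (hasDerivAt_pi.1 (d1 t).fst i).congr_deriv ?_
    rw [(hamiltonianVector_eq (hv t)).1]
    simp [frameX, frameY, Prod.fst_sum, Finset.sum_apply, Pi.single_apply]
  have dy : ∀ i t, HasDerivAt (fun t => (γ t).1.2.1 i) ((γ t).2 (frameY i (γ t).1)) t := by
    intro i t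
    refine (hasDerivAt_pi.1 (d1 t).snd.fst i).congr_deriv ?_
    rw [(hamiltonianVector_eq (hv t)).1]
    simp [frameX, frameY, Prod.fst_sum, Prod.snd_sum, Finset.sum_apply, Pi.single_apply]
  have du : ∀ i t, HasDerivAt (fun t => (γ t).2 (frameX i (γ t).1))
      (-(p (0, 0, 1) * (γ t).2 (frameY i (γ t).1))) t := fun i t => by
    have : (fun t => (γ t).2 (frameX i (γ t).1)) = fun t => (γ t).2 (Pi.single i 1, 0, 0) -
        1 / 2 * (γ t).1.2.1 i * p (0, 0, 1) := funext fun t => by rw [apply_frameX, hζ]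
    rw [this]
    refine ((dev _ t).fun_sub (((dy i t).const_mul (1 / 2)).mul_const _)).congr_deriv ?_
    rw [(hamiltonianVector_eq (hv t)).2, hζ]
    simp [Pi.single_apply]
    ring
  have dv : ∀ i t, HasDerivAt (fun t => (γ t).2 (frameY i (γ t).1))
      (p (0, 0, 1) * (γ t).2 (frameX i (γ t).1)) t := fun i t => by
    have : (fun t => (γ t).2 (frameY i (γ t).1)) = fun t => (γ t).2 (0, Pi.single i 1, 0) +
        1 / 2 * (γ t).1.1 i * p (0, 0, 1) := funext fun t => by rw [apply_frameY, hζ]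
    rw [this]
    refine ((dev _ t).fun_add (((dx i t).const_mul (1 / 2)).mul_const _)).congr_deriv ?_
    rw [(hamiltonianVector_eq (hv t)).2, hζ]
    simp [Pi.single_apply]
    ring
  have key := fun i => rotation_eq (du i) (dv i) t
  refine (d1 t).congr_deriv ?_
  rw [(hamiltonianVector_eq (hv t)).1]
  simp only [h0] at key
  congr 1
  · exact Finset.sum_congr rfl fun i _ => by rw [(key i).1, velX]
  · exact Finset.sum_congr rfl fun i _ => by rw [(key i).2, velY]

theorem hasDerivAt_psi (q : Space n) (p : Space n →L[ℝ] ℝ) (t : ℝ) :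
    HasDerivAt (fun t => psi t q p) (∑ i, velX p q t i • frameX i (psi t q p) +
      ∑ i, velY p q t i • frameY i (psi t q p)) t :=
  isTrajectory_hasDerivAt (Classical.choose_spec (exists_isTrajectory (q, p))) t

theorem psi_zero (q : Space n) (p : Space n →L[ℝ] ℝ) : psi 0 q p = q := by
  have := (Classical.choose_spec (exists_isTrajectory (q, p))).1
  simp only [psi, geodesicFlow, this]

theorem frame_sum_eq (q : Space n) (u v : Fin n → ℝ) :
    ∑ i, u i • frameX i q + ∑ i, v i • frameY i q =
      (u, v, 1 / 2 * ∑ i, (q.1 i * v i - q.2.1 i * u i)) := by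
  refine Prod.ext ?_ (Prod.ext ?_ ?_)
  · funext j
    simp [frameX, frameY, Prod.fst_sum, Finset.sum_apply, Pi.single_apply]
  · funext j
    simp [frameX, frameY, Prod.fst_sum, Prod.snd_sum, Finset.sum_apply, Pi.single_apply]
  · simp only [frameX, frameY, Prod.snd_add, Prod.snd_sum, Prod.smul_snd, smul_eq_mul,
      ← Finset.sum_add_distrib, Finset.mul_sum]
    exact Finset.sum_congr rfl fun i _ => by ring

theorem psi_fst (q : Space n) (p : Space n →L[ℝ] ℝ) (t : ℝ) (i : Fin n) :
    (psi t q p).1 i = q.1 i + (p (frameX i q) * sinInt (p (0, 0, 1)) t -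
      p (frameY i q) * cosInt (p (0, 0, 1)) t) := by
  refine eq_of_hasDerivAt_eq (g := fun t => q.1 i + (p (frameX i q) * sinInt (p (0, 0, 1)) t -
    p (frameY i q) * cosInt (p (0, 0, 1)) t))
    (fun t => hasDerivAt_pi.1 (hasDerivAt_psi q p t).fst i) (fun t => ?_) (by simp [psi_zero]) t
  rw [frame_sum_eq]
  exact ((((hasDerivAt_sinInt _ t).const_mul _).fun_sub
    ((hasDerivAt_cosInt _ t).const_mul _)).const_add _)

theorem psi_snd_fst (q : Space n) (p : Space n →L[ℝ] ℝ) (t : ℝ) (i : Fin n) :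
    (psi t q p).2.1 i = q.2.1 i + (p (frameY i q) * sinInt (p (0, 0, 1)) t +
      p (frameX i q) * cosInt (p (0, 0, 1)) t) := by
  refine eq_of_hasDerivAt_eq (g := fun t => q.2.1 i + (p (frameY i q) * sinInt (p (0, 0, 1)) t +
    p (frameX i q) * cosInt (p (0, 0, 1)) t))
    (fun t => hasDerivAt_pi.1 (hasDerivAt_psi q p t).snd.fst i) (fun t => ?_) (by simp [psi_zero]) t
  rw [frame_sum_eq]
  exact ((((hasDerivAt_sinInt _ t).const_mul _).fun_add
    ((hasDerivAt_cosInt _ t).const_mul _)).const_add _)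

/-- The `z` coordinate of `q⁻¹ * r` for the Heisenberg group law, whose left translations preserve
the contact form and the metric. -/
def vert (q r : Space n) : ℝ := r.2.2 - q.2.2 - 1 / 2 * ∑ i, (q.1 i * r.2.1 i - q.2.1 i * r.1 i)

theorem hasDerivAt_vert {q w : Space n} {c : ℝ → Space n} {t : ℝ} (h : HasDerivAt c w t) :
    HasDerivAt (fun t => vert q (c t)) (w.2.2 - 1 / 2 * ∑ i, (q.1 i * w.2.1 i - q.2.1 i * w.1 i))
      t := by
  have hs : HasDerivAt (fun t => ∑ i, (q.1 i * (c t).2.1 i - q.2.1 i * (c t).1 i))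
      (∑ i, (q.1 i * w.2.1 i - q.2.1 i * w.1 i)) t := HasDerivAt.fun_sum fun i _ =>
    ((hasDerivAt_pi.1 h.snd.fst i).const_mul (q.1 i)).fun_sub
      ((hasDerivAt_pi.1 h.fst i).const_mul (q.2.1 i))
  have hz : HasDerivAt (fun t => (c t).2.2) w.2.2 t := h.snd.snd
  exact (hz.sub_const q.2.2).fun_sub (hs.const_mul (1 / 2))

theorem vert_self (q : Space n) : vert q q = 0 := by
  have : ∑ i, (q.1 i * q.2.1 i - q.2.1 i * q.1 i) = 0 :=
    Finset.sum_eq_zero fun i _ => by ring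
  simp [vert, this]

theorem vert_psi (q : Space n) (p : Space n →L[ℝ] ℝ) (t : ℝ) :
    vert q (psi t q p) = 1 / 2 * areaInt (p (0, 0, 1)) t *
      ∑ i, (p (frameX i q) ^ 2 + p (frameY i q) ^ 2) := by
  refine eq_of_hasDerivAt_eq (f := fun t => vert q (psi t q p))
    (g := fun t => 1 / 2 * areaInt (p (0, 0, 1)) t *
      ∑ i, (p (frameX i q) ^ 2 + p (frameY i q) ^ 2))
    (fun t => hasDerivAt_vert (hasDerivAt_psi q p t)) (fun t => ?_)
    (by simp [psi_zero, vert_self]) t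
  refine (((hasDerivAt_areaInt _ t).const_mul (1 / 2)).mul_const _).congr_deriv ?_
  rw [frame_sum_eq]
  dsimp only
  rw [← mul_sub, ← Finset.sum_sub_distrib, Finset.mul_sum, Finset.mul_sum]
  refine Finset.sum_congr rfl fun i _ => ?_
  rw [psi_fst, psi_snd_fst, velX, velY]
  have h := sinInt_mul_sin_sub (p (0, 0, 1)) t
  linear_combination (-1 / 2) * (p (frameX i q) ^ 2 + p (frameY i q) ^ 2) * h

/-! ### Absolutely continuous curves and their length -/

theorem absolutelyContinuousOnInterval_comp {E F : Type*} [PseudoMetricSpace E]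
    [PseudoMetricSpace F] {f : ℝ → E} {g : E → F} {K : NNReal} {s : Set E} {a b : ℝ}
    (hg : LipschitzOnWith K g s) (hf : AbsolutelyContinuousOnInterval f a b)
    (hs : MapsTo f (uIcc a b) s) : AbsolutelyContinuousOnInterval (fun t => g (f t)) a b := by
  have h := Filter.Tendsto.const_mul (K : ℝ) hf
  rw [mul_zero] at h
  refine squeeze_zero' (Filter.Eventually.of_forall fun E => Finset.sum_nonneg fun _ _ =>
    dist_nonneg) ?_ h
  filter_upwards [Filter.mem_inf_of_right (Filter.mem_principal_self _)] with E hE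
  rw [Finset.mul_sum]
  exact Finset.sum_le_sum fun i hi =>
    hg.dist_le_mul _ (hs (hE.1 i hi).1) _ (hs (hE.1 i hi).2)

theorem absolutelyContinuousOnInterval_const {E : Type*} [PseudoMetricSpace E] (x : E) (a b : ℝ) :
    AbsolutelyContinuousOnInterval (fun _ => x) a b :=
  (LipschitzWith.const x).lipschitzOnWith.absolutelyContinuousOnInterval (K := 0)

theorem absolutelyContinuousOnInterval_sum {ι : Type*} (s : Finset ι) {f : ι → ℝ → ℝ} {a b : ℝ}
    (h : ∀ i ∈ s, AbsolutelyContinuousOnInterval (f i) a b) :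
    AbsolutelyContinuousOnInterval (fun t => ∑ i ∈ s, f i t) a b := by
  classical
  induction s using Finset.induction_on with
  | empty => simpa using absolutelyContinuousOnInterval_const (0 : ℝ) a b
  | insert i s hi ih =>
    simp only [Finset.sum_insert hi]
    exact (h i (Finset.mem_insert_self _ _)).fun_add
      (ih fun j hj => h j (Finset.mem_insert_of_mem hj))

namespace IsHorizontalCurve

variable {c : ℝ → Space n} {a b : ℝ}

theorem fst (hc : IsHorizontalCurve c a b) (i : Fin n) :
    AbsolutelyContinuousOnInterval (fun t => (c t).1 i) a b :=
  absolutelyContinuousOnInterval_comp (g := fun q : Space n => q.1 i)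
    (((ContinuousLinearMap.proj (R := ℝ) (φ := fun _ : Fin n => ℝ) i).comp
      (ContinuousLinearMap.fst ℝ (Fin n → ℝ) ((Fin n → ℝ) × ℝ))).lipschitz.lipschitzOnWith)
    hc.1 (mapsTo_univ _ _)

theorem snd_fst (hc : IsHorizontalCurve c a b) (i : Fin n) :
    AbsolutelyContinuousOnInterval (fun t => (c t).2.1 i) a b :=
  absolutelyContinuousOnInterval_comp (g := fun q : Space n => q.2.1 i)
    (((ContinuousLinearMap.proj (R := ℝ) (φ := fun _ : Fin n => ℝ) i).comp
      ((ContinuousLinearMap.fst ℝ (Fin n → ℝ) ℝ).comp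
      (ContinuousLinearMap.snd ℝ (Fin n → ℝ) ((Fin n → ℝ) × ℝ)))).lipschitz.lipschitzOnWith)
    hc.1 (mapsTo_univ _ _)

theorem snd_snd (hc : IsHorizontalCurve c a b) :
    AbsolutelyContinuousOnInterval (fun t => (c t).2.2) a b :=
  absolutelyContinuousOnInterval_comp (g := fun q : Space n => q.2.2)
    (((ContinuousLinearMap.snd ℝ (Fin n → ℝ) ℝ).comp
      (ContinuousLinearMap.snd ℝ (Fin n → ℝ) ((Fin n → ℝ) × ℝ))).lipschitz.lipschitzOnWith)
    hc.1 (mapsTo_univ _ _)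

theorem vert (hc : IsHorizontalCurve c a b) (q : Space n) :
    AbsolutelyContinuousOnInterval (fun t => vert q (c t)) a b :=
  (hc.snd_snd.fun_sub (absolutelyContinuousOnInterval_const _ _ _)).fun_sub
    ((absolutelyContinuousOnInterval_sum _ fun i _ =>
      ((hc.snd_fst i).const_mul _).fun_sub ((hc.fst i).const_mul _)).const_mul _)

theorem intervalIntegrable_speed (hc : IsHorizontalCurve c a b) (hab : a ≤ b) :
    IntervalIntegrable (fun t => tangentNorm (c t) (deriv c t)) volume a b := by
  have ix := fun i => (hc.fst i).intervalIntegrable_deriv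
  have iy := fun i => (hc.snd_fst i).intervalIntegrable_deriv
  have hbd : IntervalIntegrable (fun t => ∑ i, |deriv (fun t => (c t).1 i) t| +
      ∑ i, |deriv (fun t => (c t).2.1 i) t|) volume a b := by
    refine IntervalIntegrable.add ?_ ?_
    · simpa only [Finset.sum_fn] using IntervalIntegrable.sum Finset.univ fun i _ => (ix i).abs
    · simpa only [Finset.sum_fn] using IntervalIntegrable.sum Finset.univ fun i _ => (iy i).abs
  have hsq : IntervalIntegrable (fun t => Real.sqrt (∑ i, deriv (fun t => (c t).1 i) t ^ 2 +
      ∑ i, deriv (fun t => (c t).2.1 i) t ^ 2)) volume a b := by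
    refine hbd.mono_fun ?_ ?_
    · refine (AEMeasurable.sqrt (AEMeasurable.add ?_ ?_)).aestronglyMeasurable
      · exact Finset.aemeasurable_fun_sum _ fun i _ =>
          ((ix i).def'.aestronglyMeasurable.aemeasurable).pow_const 2
      · exact Finset.aemeasurable_fun_sum _ fun i _ =>
          ((iy i).def'.aestronglyMeasurable.aemeasurable).pow_const 2
    · refine Filter.Eventually.of_forall fun t => ?_
      have h1 : 0 ≤ ∑ i, |deriv (fun t => (c t).1 i) t| := by positivity
      have h2 : 0 ≤ ∑ i, |deriv (fun t => (c t).2.1 i) t| := by positivity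
      have e1 : ∑ i, deriv (fun t => (c t).1 i) t ^ 2 ≤
          (∑ i, |deriv (fun t => (c t).1 i) t|) ^ 2 := by
        simpa only [sq_abs] using Finset.sum_sq_le_sq_sum_of_nonneg (s := Finset.univ)
          (f := fun i => |deriv (fun t => (c t).1 i) t|) fun i _ => abs_nonneg _
      have e2 : ∑ i, deriv (fun t => (c t).2.1 i) t ^ 2 ≤
          (∑ i, |deriv (fun t => (c t).2.1 i) t|) ^ 2 := by
        simpa only [sq_abs] using Finset.sum_sq_le_sq_sum_of_nonneg (s := Finset.univ)
          (f := fun i => |deriv (fun t => (c t).2.1 i) t|) fun i _ => abs_nonneg _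
      dsimp only
      rw [Real.norm_eq_abs, Real.norm_eq_abs, abs_of_nonneg (Real.sqrt_nonneg _),
        abs_of_nonneg (by positivity)]
      refine Real.sqrt_le_iff.2 ⟨by positivity, ?_⟩
      nlinarith
  refine hsq.congr_ae ?_
  rw [Filter.EventuallyEq, ae_restrict_iff' measurableSet_uIoc]
  filter_upwards [hc.2] with t ht hm
  rw [uIoc_of_le hab] at hm
  obtain ⟨hd, hh⟩ := ht (Ioc_subset_Icc_self hm)
  have hx : ∀ i, deriv (fun t => (c t).1 i) t = (deriv c t).1 i := fun i =>
    (hasDerivAt_pi.1 hd.hasDerivAt.fst i).deriv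
  have hy : ∀ i, deriv (fun t => (c t).2.1 i) t = (deriv c t).2.1 i := fun i =>
    (hasDerivAt_pi.1 hd.hasDerivAt.snd.fst i).deriv
  simp only [hx, hy]
  rw [← tangentNorm_sq_of_mem hh]
  exact Real.sqrt_sq (Real.sqrt_nonneg _)

/-- A function that grows along the curve at most `κ` times as fast as the length increases by at
most `κ` times the length. -/
theorem sub_le_mul_curveLength (hc : IsHorizontalCurve c a b) (hab : a ≤ b) {f : ℝ → ℝ}
    (hf : AbsolutelyContinuousOnInterval f a b) (κ : ℝ)
    (h : ∀ᵐ t, t ∈ Icc a b → HasDerivAt c (deriv c t) t → deriv c t ∈ distribution (c t) →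
      deriv f t ≤ κ * tangentNorm (c t) (deriv c t)) :
    f b - f a ≤ κ * curveLength c a b := by
  rw [← hf.integral_deriv_eq_sub, curveLength, ← intervalIntegral.integral_const_mul]
  refine intervalIntegral.integral_mono_ae_restrict hab hf.intervalIntegrable_deriv
    ((hc.intervalIntegrable_speed hab).const_mul κ) ?_
  rw [Filter.EventuallyLE, ae_restrict_iff' measurableSet_Icc]
  filter_upwards [hc.2, h] with t h1 h2 ht
  exact h2 ht (h1 ht).1.hasDerivAt (h1 ht).2

/-- The calibration by a linear function, which handles the straight geodesics. -/
theorem linear_le_curveLength (hc : IsHorizontalCurve c a b) (hab : a ≤ b) {u v : Fin n → ℝ}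
    (huv : ∑ i, (u i ^ 2 + v i ^ 2) = 1) :
    ∑ i, (u i * ((c b).1 i - (c a).1 i) + v i * ((c b).2.1 i - (c a).2.1 i)) ≤
      curveLength c a b := by
  have hf : AbsolutelyContinuousOnInterval
      (fun t => ∑ i, (u i * (c t).1 i + v i * (c t).2.1 i)) a b :=
    absolutelyContinuousOnInterval_sum _ fun i _ =>
      ((hc.fst i).const_mul _).fun_add ((hc.snd_fst i).const_mul _)
  have := hc.sub_le_mul_curveLength hab hf 1 (Filter.Eventually.of_forall fun t _ hd hh => ?_)
  · rw [← Finset.sum_sub_distrib, one_mul] at this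
    refine le_trans (le_of_eq (Finset.sum_congr rfl fun i _ => by ring)) this
  · have d : HasDerivAt (fun t => ∑ i, (u i * (c t).1 i + v i * (c t).2.1 i))
        (∑ i, (u i * (deriv c t).1 i + v i * (deriv c t).2.1 i)) t :=
      HasDerivAt.fun_sum fun i _ => ((hasDerivAt_pi.1 hd.fst i).const_mul (u i)).fun_add
        ((hasDerivAt_pi.1 hd.snd.fst i).const_mul (v i))
    rw [d.deriv, one_mul]
    have hl := tangentNorm_sq_of_mem hh
    rw [← Finset.sum_add_distrib] at hl
    have h0 : 0 ≤ tangentNorm (c t) (deriv c t) := Real.sqrt_nonneg _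
    refine le_of_sq_le_sq ?_ h0
    rw [hl]
    have := Finset.sum_mul_sq_le_sq_mul_sq (Finset.univ : Finset (Fin n ⊕ Fin n))
      (Sum.elim u v) (Sum.elim (deriv c t).1 (deriv c t).2.1)
    simp only [Fintype.sum_sum_type, Sum.elim_inl, Sum.elim_inr] at this
    simp only [← Finset.sum_add_distrib] at this
    rwa [huv, one_mul] at this

end IsHorizontalCurve

/-! ### The calibration -/

theorem hasDerivAt_cos_div_sin {x : ℝ} (h : Real.sin x ≠ 0) :
    HasDerivAt (fun x => Real.cos x / Real.sin x) (-(1 + (Real.cos x / Real.sin x) ^ 2)) x := by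
  refine ((Real.hasDerivAt_cos x).div (Real.hasDerivAt_sin x) h).congr_deriv ?_
  field_simp
  ring

/-- The derivative of the calibrating function along a horizontal velocity `(x', y')` of norm `l`,
at the point with coordinates `(X, Y)` relative to the start. Here `k` is the cotangent of half the
phase, and the phase moves at the speed `|ζ| l`. The bound is a sum of weighted inequalities
`2 x' a ≤ x'² / l + l a²`: the horizontal gradient of the calibrating function has components
`a = (-ζ Y + |ζ| k X) / 2` and `(ζ X + |ζ| k Y) / 2`, and the derivative in the phase cancels the
squares of these exactly. -/
theorem calibration_le {ζ k l : ℝ} {X Y x' y' : Fin n → ℝ} (hl : 0 ≤ l)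
    (hxy : l ^ 2 = ∑ i, x' i ^ 2 + ∑ i, y' i ^ 2) :
    ζ * (1 / 2 * ∑ i, (X i * y' i - Y i * x' i)) +
      |ζ| / 4 * ((-(1 + k ^ 2) * (|ζ| * l / 2)) * ∑ i, (X i ^ 2 + Y i ^ 2) +
        k * ∑ i, (2 * X i * x' i + 2 * Y i * y' i)) ≤ 1 / 2 * l := by
  rcases hl.eq_or_lt with rfl | hl
  · have hz : ∀ i, x' i = 0 ∧ y' i = 0 := fun i => by
      rw [← Finset.sum_add_distrib, eq_comm, zero_pow two_ne_zero,
        Finset.sum_eq_zero_iff_of_nonneg fun i _ => by positivity] at hxy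
      have := hxy i (Finset.mem_univ i)
      constructor <;> nlinarith [sq_nonneg (x' i), sq_nonneg (y' i)]
    simp [hz]
  · have hζ : |ζ| ^ 2 = ζ ^ 2 := sq_abs ζ
    set m := |ζ|
    have e : ∑ i, (1 / 2 * (x' i ^ 2 + y' i ^ 2)) / l = 1 / 2 * l := by
      rw [← Finset.sum_div, ← Finset.mul_sum, Finset.sum_add_distrib, ← hxy]
      field_simp
    rw [← e]
    simp only [Finset.mul_sum, ← Finset.sum_add_distrib]
    refine Finset.sum_le_sum fun i _ => ?_
    rw [le_div_iff₀ hl]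
    have h1 := sq_nonneg (x' i - l * (-ζ * Y i / 2 + m * k * X i / 2))
    have h2 := sq_nonneg (y' i - l * (ζ * X i / 2 + m * k * Y i / 2))
    have e2 : (l ^ 2 * (X i ^ 2 + Y i ^ 2) * m ^ 2) = (l ^ 2 * (X i ^ 2 + Y i ^ 2) * ζ ^ 2) := by
      rw [hζ]
    nlinarith [h1, h2, e2]

/-- The arclength parameter of a horizontal curve. -/
theorem IsHorizontalCurve.exists_arclength {c : ℝ → Space n} {a b : ℝ}
    (hc : IsHorizontalCurve c a b) (hab : a ≤ b) : ∃ s : ℝ → ℝ,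
      AbsolutelyContinuousOnInterval s a b ∧ s a = 0 ∧ s b = curveLength c a b ∧
      (∀ t ∈ Icc a b, 0 ≤ s t ∧ s t ≤ curveLength c a b) ∧
      ∀ᵐ t, t ∈ Icc a b → HasDerivAt s (tangentNorm (c t) (deriv c t)) t := by
  have hint := hc.intervalIntegrable_speed hab
  have hl0 : ∀ t, 0 ≤ tangentNorm (c t) (deriv c t) := fun t => Real.sqrt_nonneg _
  refine ⟨fun t => ∫ v in a..t, tangentNorm (c v) (deriv c v),
    hint.absolutelyContinuousOnInterval_intervalIntegral left_mem_uIcc, by simp, rfl,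
    fun t ht => ⟨intervalIntegral.integral_nonneg ht.1 fun u _ => hl0 u,
      intervalIntegral.integral_mono_interval le_rfl ht.1 ht.2
      (Filter.Eventually.of_forall hl0) hint⟩, ?_⟩
  filter_upwards [hint.ae_hasDerivAt_integral] with t ht htm
  exact ht (by rwa [uIcc_of_le hab]) a left_mem_uIcc

theorem absolutelyContinuousOnInterval_cot {φ : ℝ → ℝ} {a b u v : ℝ}
    (hφ : AbsolutelyContinuousOnInterval φ a b) (hm : MapsTo φ (uIcc a b) (Icc u v)) (hu : 0 < u)
    (hv : v < Real.pi) :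
    AbsolutelyContinuousOnInterval (fun t => Real.cos (φ t) / Real.sin (φ t)) a b := by
  have hs : ∀ x ∈ Icc u v, Real.sin x ≠ 0 := fun x hx =>
    (Real.sin_pos_of_pos_of_lt_pi (hu.trans_le hx.1) (hx.2.trans_lt hv)).ne'
  have hd : ContDiffOn ℝ 1 (fun x => Real.cos x / Real.sin x) (Icc u v) :=
    ContDiffOn.fun_div Real.contDiff_cos.contDiffOn Real.contDiff_sin.contDiffOn hs
  obtain ⟨K, hK⟩ := hd.exists_lipschitzOnWith one_ne_zero (convex_Icc u v) isCompact_Icc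
  exact absolutelyContinuousOnInterval_comp (f := φ) (g := fun x => Real.cos x / Real.sin x)
    hK hφ hm

theorem hasDerivAt_sum_sq {c : ℝ → Space n} {w : Space n} {t : ℝ} (q : Space n)
    (h : HasDerivAt c w t) :
    HasDerivAt (fun t => ∑ i, (((c t).1 i - q.1 i) ^ 2 + ((c t).2.1 i - q.2.1 i) ^ 2))
      (∑ i, (2 * ((c t).1 i - q.1 i) * w.1 i + 2 * ((c t).2.1 i - q.2.1 i) * w.2.1 i)) t :=
  HasDerivAt.fun_sum fun i _ => by
    have h1 := ((hasDerivAt_pi.1 h.fst i).sub_const (q.1 i)).fun_pow 2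
    have h2 := ((hasDerivAt_pi.1 h.snd.fst i).sub_const (q.2.1 i)).fun_pow 2
    refine (h1.fun_add h2).congr_deriv ?_
    norm_num

theorem vert_velocity {q r w : Space n} (hw : w ∈ distribution r) :
    w.2.2 - 1 / 2 * ∑ i, (q.1 i * w.2.1 i - q.2.1 i * w.1 i) =
      1 / 2 * ∑ i, ((r.1 i - q.1 i) * w.2.1 i - (r.2.1 i - q.2.1 i) * w.1 i) := by
  have hz : contactForm r w = 0 := hw
  rw [contactForm_apply] at hz
  have e : ∑ i, ((r.1 i - q.1 i) * w.2.1 i - (r.2.1 i - q.2.1 i) * w.1 i) =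
      ∑ i, r.1 i * w.2.1 i - ∑ i, r.2.1 i * w.1 i -
        ∑ i, (q.1 i * w.2.1 i - q.2.1 i * w.1 i) := by
    simp only [← Finset.sum_sub_distrib]
    exact Finset.sum_congr rfl fun i _ => by ring
  rw [e]
  linear_combination hz

/-- The calibration inequality: `ζ z + (|ζ| / 4) cot (φ / 2) (|x|² + |y|²)`, in coordinates relative
to the start of the curve and with the phase `φ` equal to `ε` plus `|ζ|` times the arclength, grows
at most half as fast as the length. The shift `ε` keeps the phase away from the pole of the
cotangent at the start, where the function vanishes. -/
theorem IsHorizontalCurve.calibration {c : ℝ → Space n} {a b : ℝ} (hc : IsHorizontalCurve c a b)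
    (hab : a ≤ b) {ζ ε : ℝ} (hε : 0 < ε) (hL : ε + |ζ| * curveLength c a b < 2 * Real.pi) :
    ζ * Heisenberg.vert (c a) (c b) + |ζ| / 4 *
      (Real.cos ((ε + |ζ| * curveLength c a b) / 2) / Real.sin ((ε + |ζ| * curveLength c a b) / 2) *
        ∑ i, (((c b).1 i - (c a).1 i) ^ 2 + ((c b).2.1 i - (c a).2.1 i) ^ 2)) ≤
      1 / 2 * curveLength c a b := by
  obtain ⟨s, hsac, hsa, hsb, hsm, hsd⟩ := hc.exists_arclength hab
  have hφm : ∀ t ∈ Icc a b, (ε + |ζ| * s t) / 2 ∈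
      Icc (ε / 2) ((ε + |ζ| * curveLength c a b) / 2) := fun t ht => by
    have h1 := mul_nonneg (abs_nonneg ζ) (hsm t ht).1
    have h2 := mul_le_mul_of_nonneg_left (hsm t ht).2 (abs_nonneg ζ)
    constructor <;> linarith
  have hφac : AbsolutelyContinuousOnInterval (fun t => (ε + |ζ| * s t) / 2) a b := by
    have := ((absolutelyContinuousOnInterval_const ε a b).fun_add
      (hsac.const_mul |ζ|)).const_mul (1 / 2)
    have e : (fun t => (ε + |ζ| * s t) / 2) = fun t => 1 / 2 * (ε + |ζ| * s t) :=
      funext fun t => by ring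
    rwa [e]
  have hcot := absolutelyContinuousOnInterval_cot hφac (by rw [uIcc_of_le hab]; exact hφm)
    (half_pos hε) (by linarith)
  have hx : ∀ i, AbsolutelyContinuousOnInterval (fun t => (c t).1 i - (c a).1 i) a b := fun i =>
    (hc.fst i).fun_sub (absolutelyContinuousOnInterval_const _ _ _)
  have hy : ∀ i, AbsolutelyContinuousOnInterval (fun t => (c t).2.1 i - (c a).2.1 i) a b := fun i =>
    (hc.snd_fst i).fun_sub (absolutelyContinuousOnInterval_const _ _ _)
  have hR : AbsolutelyContinuousOnInterval (fun t =>
      ∑ i, (((c t).1 i - (c a).1 i) ^ 2 + ((c t).2.1 i - (c a).2.1 i) ^ 2)) a b := by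
    simp only [sq]
    exact absolutelyContinuousOnInterval_sum _ fun i _ =>
      ((hx i).fun_mul (hx i)).fun_add ((hy i).fun_mul (hy i))
  have hG := ((hc.vert (c a)).const_mul ζ).fun_add ((hcot.fun_mul hR).const_mul (|ζ| / 4))
  have key := hc.sub_le_mul_curveLength hab hG (1 / 2) ?_
  · rw [hsb] at key
    simpa [vert_self] using key
  · filter_upwards [hsd] with t ht1 htm hd hh
    have dφ := (((ht1 htm).const_mul |ζ|).const_add ε).div_const 2
    have hsin : Real.sin ((ε + |ζ| * s t) / 2) ≠ 0 :=
      (Real.sin_pos_of_pos_of_lt_pi (by linarith [(hφm t htm).1])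
        (by linarith [(hφm t htm).2])).ne'
    have dcot := (hasDerivAt_cos_div_sin hsin).comp t dφ
    have dG := ((hasDerivAt_vert (q := c a) hd).const_mul ζ).fun_add
      ((dcot.fun_mul (hasDerivAt_sum_sq (c a) hd)).const_mul (|ζ| / 4))
    refine le_trans (le_of_eq dG.deriv) ?_
    rw [vert_velocity hh]
    exact calibration_le (ζ := ζ) (X := fun i => (c t).1 i - (c a).1 i)
      (Y := fun i => (c t).2.1 i - (c a).2.1 i) (Real.sqrt_nonneg _) (tangentNorm_sq_of_mem hh)

/-! ### Geodesics up to the time `2π / |ζ|` are minimizing -/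

theorem frame_sum_mem_distribution (q : Space n) (u v : Fin n → ℝ) :
    ∑ i, u i • frameX i q + ∑ i, v i • frameY i q ∈ distribution q :=
  add_mem (sum_mem fun i _ => Submodule.smul_mem _ _ (contactForm_frameX i q))
    (sum_mem fun i _ => Submodule.smul_mem _ _ (contactForm_frameY i q))

theorem tangentNorm_frame_sum (q : Space n) (u v : Fin n → ℝ) :
    tangentNorm q (∑ i, u i • frameX i q + ∑ i, v i • frameY i q) =
      Real.sqrt (∑ i, (u i ^ 2 + v i ^ 2)) := by
  have h := tangentNorm_sq_of_mem (frame_sum_mem_distribution q u v)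
  rw [← Real.sqrt_sq (show 0 ≤ tangentNorm q _ from Real.sqrt_nonneg _), h, frame_sum_eq,
    Finset.sum_add_distrib]

theorem isHorizontalCurve_of_hasDerivAt {c : ℝ → Space n} {u v : ℝ → Fin n → ℝ}
    (hc : ∀ t, HasDerivAt c (∑ i, u t i • frameX i (c t) + ∑ i, v t i • frameY i (c t)) t)
    (hu : Continuous u) (hv : Continuous v) (a b : ℝ) : IsHorizontalCurve c a b := by
  have hcc : Continuous c := continuous_iff_continuousAt.2 fun t => (hc t).continuousAt
  refine ⟨ContDiffOn.absolutelyContinuousOnInterval (ContDiff.contDiffOn ?_),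
    Filter.Eventually.of_forall fun t _ => ⟨(hc t).differentiableAt, ?_⟩⟩
  · refine contDiff_one_iff_deriv.2 ⟨fun t => (hc t).differentiableAt, ?_⟩
    have : deriv c = fun t => (u t, v t,
        1 / 2 * ∑ i, ((c t).1 i * v t i - (c t).2.1 i * u t i)) := funext fun t => by
      rw [(hc t).deriv, frame_sum_eq]
    rw [this]
    fun_prop
  · rw [(hc t).deriv]
    exact frame_sum_mem_distribution _ _ _

theorem continuous_velX (p : Space n →L[ℝ] ℝ) (q : Space n) : Continuous (velX p q) := by
  unfold velX; fun_prop

theorem continuous_velY (p : Space n →L[ℝ] ℝ) (q : Space n) : Continuous (velY p q) := by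
  unfold velY; fun_prop

theorem isHorizontalCurve_psi (q : Space n) (p : Space n →L[ℝ] ℝ) (a b : ℝ) :
    IsHorizontalCurve (fun t => psi t q p) a b :=
  isHorizontalCurve_of_hasDerivAt (hasDerivAt_psi q p) (continuous_velX p q)
    (continuous_velY p q) a b

theorem sum_sq_eq_one {q : Space n} {p : Space n →L[ℝ] ℝ} (hp : IsUnitHorizontal q p) :
    ∑ i, (p (frameX i q) ^ 2 + p (frameY i q) ^ 2) = 1 := by
  obtain ⟨u, hu, huv, h1⟩ := hp
  have hX : ∀ i, p (frameX i q) = u.1 i := fun i => by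
    rw [huv _ (contactForm_frameX i q), metric, contactForm_frameX]
    simp [frameX, Pi.single_apply]
  have hY : ∀ i, p (frameY i q) = u.2.1 i := fun i => by
    rw [huv _ (contactForm_frameY i q), metric, contactForm_frameY]
    simp [frameY, Pi.single_apply]
  have := tangentNorm_sq_of_mem hu
  rw [h1, ← Finset.sum_add_distrib] at this
  simp only [hX, hY, ← this, one_pow]

theorem curveLength_psi {q : Space n} {p : Space n →L[ℝ] ℝ}
    (hp : ∑ i, (p (frameX i q) ^ 2 + p (frameY i q) ^ 2) = 1) (a b : ℝ) :
    curveLength (fun t => psi t q p) a b = b - a := by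
  have : ∀ t, tangentNorm (psi t q p) (deriv (fun t => psi t q p) t) = 1 := fun t => by
    rw [(hasDerivAt_psi q p t).deriv, tangentNorm_frame_sum, Real.sqrt_eq_one, ← hp]
    refine Finset.sum_congr rfl fun i _ => ?_
    rw [velX, velY]
    linear_combination (p (frameX i q) ^ 2 + p (frameY i q) ^ 2) *
      Real.sin_sq_add_cos_sq (p (0, 0, 1) * t)
  simp [curveLength, this]

theorem sum_sq_psi_sub {q : Space n} {p : Space n →L[ℝ] ℝ}
    (hp : ∑ i, (p (frameX i q) ^ 2 + p (frameY i q) ^ 2) = 1) (t : ℝ) :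
    ∑ i, (((psi t q p).1 i - q.1 i) ^ 2 + ((psi t q p).2.1 i - q.2.1 i) ^ 2) =
      sinInt (p (0, 0, 1)) t ^ 2 + cosInt (p (0, 0, 1)) t ^ 2 := by
  set m := sinInt (p (0, 0, 1)) t ^ 2 + cosInt (p (0, 0, 1)) t ^ 2 with hm
  rw [← one_mul m, ← hp, Finset.sum_mul]
  refine Finset.sum_congr rfl fun i _ => ?_
  rw [psi_fst, psi_snd_fst, hm]
  ring

theorem sin_abs_mul_div (ζ T : ℝ) : Real.sin (|ζ| * T) / |ζ| = Real.sin (ζ * T) / ζ := by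
  rcases abs_cases ζ with h | h
  · rw [h.1]
  · rw [h.1, neg_mul, Real.sin_neg, neg_div_neg_eq]

theorem cos_abs_mul (ζ T : ℝ) : Real.cos (|ζ| * T) = Real.cos (ζ * T) := by
  rcases abs_cases ζ with h | h
  · rw [h.1]
  · rw [h.1, neg_mul, Real.cos_neg]

/-- The calibration inequality is an equality on the geodesic with vertical momentum `ζ`. -/
theorem calibration_value {ζ T : ℝ} (hT : 0 < T) (h0 : ζ ≠ 0) (h : |ζ| * T < 2 * Real.pi) :
    ζ * (1 / 2 * areaInt ζ T) + |ζ| / 4 * (Real.cos (|ζ| * T / 2) / Real.sin (|ζ| * T / 2) *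
      (sinInt ζ T ^ 2 + cosInt ζ T ^ 2)) = T / 2 := by
  have hm : 0 < |ζ| := abs_pos.2 h0
  have hs : Real.sin (|ζ| * T / 2) ≠ 0 :=
    (Real.sin_pos_of_pos_of_lt_pi (by positivity) (by linarith)).ne'
  rw [sinInt_sq_add_cosInt_sq h0, areaInt, sinInt_of_ne h0, ← sin_abs_mul_div, ← cos_abs_mul,
    ← sq_abs ζ]
  have e : |ζ| * T = 2 * (|ζ| * T / 2) := by ring
  have e1 : Real.sin (|ζ| * T) = 2 * Real.sin (|ζ| * T / 2) * Real.cos (|ζ| * T / 2) := by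
    conv_lhs => rw [e, Real.sin_two_mul]
  have e2 : 1 - Real.cos (|ζ| * T) = 2 * Real.sin (|ζ| * T / 2) ^ 2 := by
    conv_lhs => rw [e, Real.cos_two_mul]
    linear_combination (-2) * Real.sin_sq_add_cos_sq (|ζ| * T / 2)
  rw [e1, e2]
  field_simp
  ring

theorem isLengthMinimizing_psi {q : Space n} {p : Space n →L[ℝ] ℝ}
    (hp : ∑ i, (p (frameX i q) ^ 2 + p (frameY i q) ^ 2) = 1) {T : ℝ} (hT : 0 < T)
    (h : |p (0, 0, 1)| * T ≤ 2 * Real.pi) : IsLengthMinimizing (fun t => psi t q p) 0 T := by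
  refine ⟨isHorizontalCurve_psi q p 0 T, fun c a b hab hc ha hb => ?_⟩
  rw [curveLength_psi hp, sub_zero]
  replace ha : c a = q := ha.trans (psi_zero q p)
  by_contra! hlt
  rcases eq_or_ne (p (0, 0, 1)) 0 with h0 | h0
  -- A zero vertical momentum gives a straight line.
  · have := hc.linear_le_curveLength hab hp
    rw [ha, hb] at this
    simp only [psi_fst, psi_snd_fst, h0, sinInt_zero_left, cosInt_zero_left] at this
    have e : ∑ i, (p (frameX i q) * (q.1 i + (p (frameX i q) * T - p (frameY i q) * 0) - q.1 i) +
        p (frameY i q) * (q.2.1 i + (p (frameY i q) * T + p (frameX i q) * 0) - q.2.1 i)) = T := by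
      conv_rhs => rw [← one_mul T, ← hp, Finset.sum_mul]
      exact Finset.sum_congr rfl fun i _ => by ring
    linarith
  · have hm : 0 < |p (0, 0, 1)| := abs_pos.2 h0
    have hlt' := mul_lt_mul_of_pos_left hlt hm
    rcases h.lt_or_eq with h | h
    -- The shift makes the final phase of the shorter curve equal to that of the geodesic.
    · have := hc.calibration hab (ζ := p (0, 0, 1))
        (ε := |p (0, 0, 1)| * (T - curveLength c a b))
        (mul_pos hm (by linarith)) (by linarith)
      rw [ha, hb, vert_psi, hp, mul_one, sum_sq_psi_sub hp, ← mul_add, sub_add_cancel,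
        calibration_value hT h0 h] at this
      linarith
    -- The geodesic closes up in the `(x, y)` space, so that the cotangent term vanishes and any
    -- small shift will do.
    · have := hc.calibration hab (ζ := p (0, 0, 1))
        (ε := (2 * Real.pi - |p (0, 0, 1)| * curveLength c a b) / 2) (by linarith) (by linarith)
      have hN : sinInt (p (0, 0, 1)) T ^ 2 + cosInt (p (0, 0, 1)) T ^ 2 = 0 := by
        rw [sinInt_sq_add_cosInt_sq h0, ← cos_abs_mul, h, Real.cos_two_pi]; simp
      have hS : sinInt (p (0, 0, 1)) T = 0 := by
        rw [sinInt_of_ne h0, ← sin_abs_mul_div, h, Real.sin_two_pi, zero_div]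
      rw [ha, hb, vert_psi, hp, mul_one, sum_sq_psi_sub hp, hN, areaInt, hS] at this
      have e : p (0, 0, 1) * (1 / 2 * ((T - 0) / p (0, 0, 1))) = T / 2 := by
        field_simp; ring
      rw [e] at this
      linarith

/-! ### Geodesics beyond the time `2π / |ζ|` are not minimizing -/

/-- The lift of the plane curve `(A, B)`, drawn in the complex line of `ℝⁿ × ℝⁿ` spanned by `(e, f)`
and its rotation `(-f, e)`, left translated to `q`. It is horizontal when `Z` is the area swept out
by `(A, B)`, see `hasDerivAt_planarLift`. -/
def planarLift (q : Space n) (e f : Fin n → ℝ) (A B Z : ℝ → ℝ) (t : ℝ) : Space n :=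
  (fun i => q.1 i + (e i * A t - f i * B t), fun i => q.2.1 i + (f i * A t + e i * B t),
    q.2.2 + Z t + 1 / 2 * ∑ i, (q.1 i * (f i * A t + e i * B t) -
      q.2.1 i * (e i * A t - f i * B t)))

theorem hasDerivAt_planarLift (q : Space n) {e f : Fin n → ℝ} (hef : ∑ i, (e i ^ 2 + f i ^ 2) = 1)
    {A B Z : ℝ → ℝ} {A' B' t : ℝ} (hA : HasDerivAt A A' t) (hB : HasDerivAt B B' t)
    (hZ : HasDerivAt Z (1 / 2 * (A t * B' - B t * A')) t) :
    HasDerivAt (planarLift q e f A B Z)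
      (∑ i, (e i * A' - f i * B') • frameX i (planarLift q e f A B Z t) +
        ∑ i, (f i * A' + e i * B') • frameY i (planarLift q e f A B Z t)) t := by
  have hx : ∀ i, HasDerivAt (fun t => e i * A t - f i * B t) (e i * A' - f i * B') t := fun i =>
    (hA.const_mul _).fun_sub (hB.const_mul _)
  have hy : ∀ i, HasDerivAt (fun t => f i * A t + e i * B t) (f i * A' + e i * B') t := fun i =>
    (hA.const_mul _).fun_add (hB.const_mul _)
  have hs : HasDerivAt (fun t => ∑ i, (q.1 i * (f i * A t + e i * B t) -
      q.2.1 i * (e i * A t - f i * B t))) (∑ i, (q.1 i * (f i * A' + e i * B') -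
      q.2.1 i * (e i * A' - f i * B'))) t :=
    HasDerivAt.fun_sum fun i _ => ((hy i).const_mul _).fun_sub ((hx i).const_mul _)
  refine (HasDerivAt.prodMk (hasDerivAt_pi.2 fun i => (hx i).const_add (q.1 i))
    (HasDerivAt.prodMk (hasDerivAt_pi.2 fun i => (hy i).const_add (q.2.1 i))
    ((hZ.const_add q.2.2).fun_add (hs.const_mul (1 / 2))))).congr_deriv ?_
  rw [frame_sum_eq]
  refine Prod.ext rfl (Prod.ext rfl ?_)
  dsimp only [planarLift]
  rw [← one_mul (A t * B' - B t * A'), ← hef, ← mul_add, Finset.sum_mul, ← Finset.sum_add_distrib]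
  congr 1
  exact Finset.sum_congr rfl fun i _ => by ring

/-- For `x > 2π`, the chord and circle replacing an arc of angle `x` of the unit circle are shorter,
in the mean square, than the arc. -/
theorem two_mul_one_sub_cos_add_lt {x : ℝ} (hx : 2 * Real.pi < x) :
    2 * (1 - Real.cos x) + 2 * Real.pi * (x - Real.sin x) < x ^ 2 := by
  obtain ⟨d, hd, rfl⟩ : ∃ d, 0 < d ∧ x = d + 2 * Real.pi :=
    ⟨x - 2 * Real.pi, by linarith, by ring⟩
  rw [Real.cos_add_two_pi, Real.sin_add_two_pi]
  have h1 := Real.one_sub_sq_div_two_le_cos (x := d)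
  have h2 : -d < Real.sin d := by
    have := (abs_lt.1 (Real.abs_sin_lt_abs hd.ne')).1
    rwa [abs_of_pos hd] at this
  nlinarith [mul_pos Real.pi_pos (by linarith : 0 < Real.sin d + d)]

/-- A competitor for long geodesics: the lift of the chord `s ↦ d s`, `0 ≤ s ≤ 1`, with a full
circle of radius `r` superposed. It sweeps out the area `± π r²`, since the center of the circle
lies on the line of the chord, and its mean square speed is `d² + (2π)² r²`. -/
theorem exists_chord_add_circle (q : Space n) {e f : Fin n → ℝ}
    (hef : ∑ i, (e i ^ 2 + f i ^ 2) = 1) (d r : ℝ) {σ T : ℝ} (hσ : σ ^ 2 = 1) (hT : 0 < T) :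
    ∃ c : ℝ → Space n, IsHorizontalCurve c 0 1 ∧ c 0 = q ∧
      (∀ i, (c 1).1 i = q.1 i + e i * d) ∧ (∀ i, (c 1).2.1 i = q.2.1 i + f i * d) ∧
      vert q (c 1) = σ * (Real.pi * r ^ 2) ∧
      curveLength c 0 1 ≤ (d ^ 2 + (2 * Real.pi) ^ 2 * r ^ 2 + T ^ 2) / (2 * T) := by
  obtain ⟨ω, hω⟩ : ∃ ω, ω = 2 * Real.pi := ⟨_, rfl⟩
  have hω0 : ω ≠ 0 := by rw [hω]; positivity
  rw [← hω]
  have hcos : Real.cos ω = 1 := by rw [hω, Real.cos_two_pi]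
  have hsin : Real.sin ω = 0 := by rw [hω, Real.sin_two_pi]
  have dc : ∀ t, HasDerivAt (fun t => Real.cos (ω * t)) (-(Real.sin (ω * t) * ω)) t := fun t => by
    simpa using ((hasDerivAt_id t).const_mul ω).cos
  have ds : ∀ t, HasDerivAt (fun t => Real.sin (ω * t)) (Real.cos (ω * t) * ω) t := fun t => by
    simpa using ((hasDerivAt_id t).const_mul ω).sin
  obtain ⟨A, hA⟩ : ∃ A : ℝ → ℝ, A = fun t => d * t + r * (Real.cos (ω * t) - 1) := ⟨_, rfl⟩
  obtain ⟨B, hB⟩ : ∃ B : ℝ → ℝ, B = fun t => σ * (r * Real.sin (ω * t)) := ⟨_, rfl⟩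
  obtain ⟨Z, hZ⟩ : ∃ Z : ℝ → ℝ, Z = fun t => 1 / 2 * σ * r * (d * t * Real.sin (ω * t) +
    ω * r * t - r * Real.sin (ω * t) + 2 * d / ω * (Real.cos (ω * t) - 1)) := ⟨_, rfl⟩
  have dA : ∀ t, HasDerivAt A (d - r * (Real.sin (ω * t) * ω)) t := fun t => by
    rw [hA]
    exact (((hasDerivAt_id t).const_mul d).fun_add (((dc t).sub_const 1).const_mul r)).congr_deriv
      (by ring)
  have dB : ∀ t, HasDerivAt B (σ * (r * (Real.cos (ω * t) * ω))) t := fun t => by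
    rw [hB]
    exact ((ds t).const_mul r).const_mul σ
  have dZ : ∀ t, HasDerivAt Z (1 / 2 * (A t * (σ * (r * (Real.cos (ω * t) * ω))) -
      B t * (d - r * (Real.sin (ω * t) * ω)))) t := fun t => by
    rw [hA, hB, hZ]
    refine (((((((hasDerivAt_id t).const_mul d).fun_mul (ds t)).fun_add
      ((hasDerivAt_id t).const_mul (ω * r))).fun_sub ((ds t).const_mul r)).fun_add
      (((dc t).sub_const 1).const_mul (2 * d / ω))).const_mul (1 / 2 * σ * r)).congr_deriv ?_
    have : 2 * d / ω * -(Real.sin (ω * t) * ω) = - 2 * d * Real.sin (ω * t) := by field_simp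
    rw [this]
    simp only [id]
    linear_combination (-1 / 2 * σ * r ^ 2 * ω) * Real.sin_sq_add_cos_sq (ω * t)
  have hder := fun t => hasDerivAt_planarLift q hef (dA t) (dB t) (dZ t)
  have hhor : IsHorizontalCurve (planarLift q e f A B Z) 0 1 :=
    isHorizontalCurve_of_hasDerivAt hder (by fun_prop) (by fun_prop) 0 1
  have hA1 : A 1 = d := by simp [hA, hcos]
  have hB1 : B 1 = 0 := by simp [hB, hsin]
  have hZ1 : Z 1 = σ * (Real.pi * r ^ 2) := by
    simp only [hZ, mul_one, hcos, hsin]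
    rw [hω]; ring
  refine ⟨planarLift q e f A B Z, hhor, by simp [planarLift, hA, hB, hZ],
    fun i => by simp [planarLift, hA1, hB1], fun i => by simp [planarLift, hA1, hB1], ?_, ?_⟩
  · simp only [vert, planarLift, hZ1, mul_add, mul_sub, Finset.sum_add_distrib,
      Finset.sum_sub_distrib, mul_comm (q.2.1 _) (q.1 _)]
    ring
  · have hF : ∀ t ∈ uIcc (0 : ℝ) 1, HasDerivAt (fun t => ((d ^ 2 + ω ^ 2 * r ^ 2 + T ^ 2) * t +
        2 * r * d * Real.cos (ω * t)) / (2 * T))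
        ((d ^ 2 + ω ^ 2 * r ^ 2 + T ^ 2 - 2 * r * d * (Real.sin (ω * t) * ω)) / (2 * T)) t :=
      fun t _ => ((((hasDerivAt_id t).const_mul _).fun_add
        ((dc t).const_mul (2 * r * d))).div_const _).congr_deriv (by ring)
    have hint := intervalIntegral.integral_eq_sub_of_hasDerivAt hF
      (Continuous.intervalIntegrable (by fun_prop) _ _)
    simp only [mul_one, mul_zero, Real.cos_zero, hcos] at hint
    have : (d ^ 2 + ω ^ 2 * r ^ 2 + T ^ 2 + 2 * r * d) / (2 * T) - (0 + 2 * r * d) / (2 * T) =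
      (d ^ 2 + ω ^ 2 * r ^ 2 + T ^ 2) / (2 * T) := by ring
    rw [← this, ← hint]
    refine intervalIntegral.integral_mono_on zero_le_one (hhor.intervalIntegrable_speed zero_le_one)
      (Continuous.intervalIntegrable (by fun_prop) _ _) fun t _ => ?_
    rw [(hder t).deriv, tangentNorm_frame_sum, le_div_iff₀ (by positivity)]
    have hs : ∑ i, ((e i * (d - r * (Real.sin (ω * t) * ω)) -
        f i * (σ * (r * (Real.cos (ω * t) * ω)))) ^ 2 + (f i * (d - r * (Real.sin (ω * t) * ω)) +
        e i * (σ * (r * (Real.cos (ω * t) * ω)))) ^ 2) =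
        d ^ 2 + ω ^ 2 * r ^ 2 - 2 * r * d * (Real.sin (ω * t) * ω) := by
      have : d ^ 2 + ω ^ 2 * r ^ 2 - 2 * r * d * (Real.sin (ω * t) * ω) =
          (d - r * (Real.sin (ω * t) * ω)) ^ 2 + (σ * (r * (Real.cos (ω * t) * ω))) ^ 2 := by
        linear_combination (-r ^ 2 * ω ^ 2) * Real.sin_sq_add_cos_sq (ω * t) -
          (r * (Real.cos (ω * t) * ω)) ^ 2 * hσ
      rw [this]
      generalize d - r * (Real.sin (ω * t) * ω) = x
      generalize σ * (r * (Real.cos (ω * t) * ω)) = y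
      rw [← one_mul (x ^ 2 + y ^ 2), ← hef, Finset.sum_mul]
      exact Finset.sum_congr rfl fun i _ => by ring
    have hs0 : 0 ≤ d ^ 2 + ω ^ 2 * r ^ 2 - 2 * r * d * (Real.sin (ω * t) * ω) := by
      rw [← hs]; positivity
    rw [hs]
    -- `√x ≤ (x + T²) / (2 T)` replaces the Cauchy-Schwarz inequality.
    have := Real.sq_sqrt hs0
    nlinarith [sq_nonneg (Real.sqrt
      (d ^ 2 + ω ^ 2 * r ^ 2 - 2 * r * d * (Real.sin (ω * t) * ω)) - T)]

theorem ext_of_vert {q r s : Space n} (h1 : ∀ i, r.1 i = s.1 i) (h2 : ∀ i, r.2.1 i = s.2.1 i)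
    (h3 : vert q r = vert q s) : r = s := by
  refine Prod.ext (funext h1) (Prod.ext (funext h2) ?_)
  simp only [vert, h1, h2] at h3
  linarith

theorem abs_areaInt_mul_sq {ζ T : ℝ} (hT : 0 < T) (h0 : ζ ≠ 0) :
    |areaInt ζ T| * ζ ^ 2 = |ζ| * T - Real.sin (|ζ| * T) := by
  have hm : 0 < |ζ| := abs_pos.2 h0
  have h1 : |ζ| * areaInt ζ T * ζ = |ζ| * T - Real.sin (|ζ| * T) := by
    have : Real.sin (|ζ| * T) = |ζ| * (Real.sin (ζ * T) / ζ) := by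
      rw [← sin_abs_mul_div]; field_simp
    rw [areaInt, sinInt_of_ne h0, this]; field_simp
  have h2 : 0 < |ζ| * T - Real.sin (|ζ| * T) := by
    have := Real.sin_lt (x := |ζ| * T) (by positivity)
    linarith
  rw [← abs_of_pos h2, ← h1, abs_mul, abs_mul, abs_abs, ← sq_abs ζ]
  ring

theorem not_isLengthMinimizing_psi {q : Space n} {p : Space n →L[ℝ] ℝ}
    (hp : ∑ i, (p (frameX i q) ^ 2 + p (frameY i q) ^ 2) = 1) {T : ℝ} (hT : 0 < T)
    (h : 2 * Real.pi < |p (0, 0, 1)| * T) : ¬ IsLengthMinimizing (fun t => psi t q p) 0 T := by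
  rintro ⟨-, hmin⟩
  set ζ := p (0, 0, 1) with hζ
  have h0 : ζ ≠ 0 := fun h0 => by
    rw [h0, abs_zero, zero_mul] at h; linarith [Real.pi_pos]
  obtain ⟨K, hK⟩ : ∃ K, K = areaInt ζ T := ⟨_, rfl⟩
  obtain ⟨σ, hσ, hσK⟩ : ∃ σ : ℝ, σ ^ 2 = 1 ∧ K = σ * |K| := by
    rcases abs_cases K with h | h
    · exact ⟨1, by norm_num, by linarith⟩
    · exact ⟨-1, by norm_num, by linarith⟩
  obtain ⟨r, hr⟩ : ∃ r, 2 * Real.pi * r ^ 2 = |K| :=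
    ⟨Real.sqrt (|K| / (2 * Real.pi)), by rw [Real.sq_sqrt (by positivity)]; field_simp⟩
  obtain ⟨d, hd⟩ : ∃ d, d = 2 * Real.sin (ζ * T / 2) / ζ := ⟨_, rfl⟩
  obtain ⟨e, he⟩ : ∃ e : Fin n → ℝ, ∀ i, e i = p (frameX i q) * Real.cos (ζ * T / 2) -
    p (frameY i q) * Real.sin (ζ * T / 2) := ⟨_, fun _ => rfl⟩
  obtain ⟨f, hf⟩ : ∃ f : Fin n → ℝ, ∀ i, f i = p (frameY i q) * Real.cos (ζ * T / 2) +
    p (frameX i q) * Real.sin (ζ * T / 2) := ⟨_, fun _ => rfl⟩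
  have hef : ∑ i, (e i ^ 2 + f i ^ 2) = 1 := by
    rw [← hp]
    refine Finset.sum_congr rfl fun i _ => ?_
    rw [he, hf]
    linear_combination (p (frameX i q) ^ 2 + p (frameY i q) ^ 2) *
      Real.sin_sq_add_cos_sq (ζ * T / 2)
  -- `d` is the signed length and `(e, f)` the direction of the chord of the geodesic, an arc of
  -- angle `ζ T`; `r` is chosen so that the circle sweeps out the right area.
  obtain ⟨c, hc, hc0, hcx, hcy, hcz, hcl⟩ := exists_chord_add_circle q hef d r hσ hT
  have eT : ζ * T = 2 * (ζ * T / 2) := by ring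
  have eS : sinInt ζ T = Real.cos (ζ * T / 2) * d := by
    rw [sinInt_of_ne h0, hd]
    conv_lhs => rw [eT, Real.sin_two_mul]
    ring
  have eC : cosInt ζ T = Real.sin (ζ * T / 2) * d := by
    rw [cosInt, hd]
    conv_lhs => rw [eT, Real.cos_two_mul]
    linear_combination (2 / ζ) * (- Real.sin_sq_add_cos_sq (ζ * T / 2))
  have hend : c 1 = psi T q p := by
    refine ext_of_vert (q := q) (fun i => ?_) (fun i => ?_) ?_
    · rw [hcx, psi_fst, ← hζ, eS, eC, he]; ring
    · rw [hcy, psi_snd_fst, ← hζ, eS, eC, hf]; ring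
    · rw [hcz, vert_psi, hp, ← hζ, ← hK, hσK, ← hr]; ring
  have hle := hmin c 0 1 zero_le_one hc (hc0.trans (psi_zero q p).symm) hend
  rw [curveLength_psi hp, sub_zero] at hle
  have hd2 : d ^ 2 * ζ ^ 2 = 2 * (1 - Real.cos (ζ * T)) := by
    have h1 : d * ζ = 2 * Real.sin (ζ * T / 2) := by rw [hd]; field_simp
    conv_rhs => rw [eT, Real.cos_two_mul]
    linear_combination (d * ζ + 2 * Real.sin (ζ * T / 2)) * h1 +
      4 * Real.sin_sq_add_cos_sq (ζ * T / 2)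
  have hfin : d ^ 2 + (2 * Real.pi) ^ 2 * r ^ 2 < T ^ 2 := by
    have h1 := two_mul_one_sub_cos_add_lt h
    rw [cos_abs_mul, ← hd2, ← abs_areaInt_mul_sq hT h0, ← hK, ← hr, mul_pow, sq_abs] at h1
    have : 0 < ζ ^ 2 := by positivity
    refine lt_of_mul_lt_mul_right ?_ this.le
    linarith
  have := hle.trans hcl
  rw [le_div_iff₀ (by positivity)] at this
  linarith

/-! ### Conjugate times -/

/-- The numerator of the derivative of the ratio of area to squared chord of an arc of angle `x`. -/
theorem two_sub_two_mul_cos_sub_pos {x : ℝ} (h0 : x ≠ 0) (h : |x| < 2 * Real.pi) :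
    0 < 2 - 2 * Real.cos x - x * Real.sin x := by
  have key : ∀ y, 0 < y → y < Real.pi →
      0 < 2 - 2 * Real.cos (2 * y) - 2 * y * Real.sin (2 * y) := by
    intro y hy hy'
    have hs := Real.sin_pos_of_pos_of_lt_pi hy hy'
    have h1 : y * Real.cos y < Real.sin y := by
      rcases le_or_gt (Real.cos y) 0 with hc | hc
      · exact (mul_nonpos_of_nonneg_of_nonpos hy.le hc).trans_lt hs
      · have hlt : y < Real.pi / 2 := by
          by_contra! hge
          exact hc.not_ge (Real.cos_nonpos_of_pi_div_two_le_of_le hge (by linarith))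
        have := Real.lt_tan hy hlt
        rwa [Real.tan_eq_sin_div_cos, lt_div_iff₀ hc] at this
    have e : 2 - 2 * Real.cos (2 * y) - 2 * y * Real.sin (2 * y) =
        4 * Real.sin y * (Real.sin y - y * Real.cos y) := by
      rw [Real.cos_two_mul, Real.sin_two_mul]
      linear_combination (-4) * Real.sin_sq_add_cos_sq y
    rw [e]
    exact mul_pos (by positivity) (by linarith)
  have := key (|x| / 2) (by positivity) (by linarith)
  rw [mul_div_cancel₀ _ (two_ne_zero' ℝ), Real.cos_abs] at this
  rcases abs_cases x with h | h <;> rw [h.1] at this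
  · exact this
  · rwa [Real.sin_neg, neg_mul_neg] at this

/-- The two nonvanishing quantities are those that make the differential of `ψ_t(q, ·)` injective.
The second is, up to the factor `(S² + C²)²`, the derivative in `ζ` of the ratio `K / (S² + C²)` of
area to squared chord. -/
theorem exists_hasDerivAt_left (ζ : ℝ) {t : ℝ} (ht : 0 < t) : ∃ S' C' K' : ℝ,
    HasDerivAt (fun ζ => sinInt ζ t) S' ζ ∧ HasDerivAt (fun ζ => cosInt ζ t) C' ζ ∧
    HasDerivAt (fun ζ => areaInt ζ t) K' ζ ∧ (|ζ| * t < 2 * Real.pi →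
      sinInt ζ t ^ 2 + cosInt ζ t ^ 2 ≠ 0 ∧ K' * (sinInt ζ t ^ 2 + cosInt ζ t ^ 2) -
        2 * areaInt ζ t * (sinInt ζ t * S' + cosInt ζ t * C') ≠ 0) := by
  rcases eq_or_ne ζ 0 with rfl | h0
  · refine ⟨_, _, _, hasDerivAt_sinInt_left_zero ht, hasDerivAt_cosInt_left_zero ht,
      hasDerivAt_areaInt_left_zero ht, fun _ => ⟨?_, ?_⟩⟩
    · simpa using ht.ne'
    · simpa using ht.ne'
  · refine ⟨_, _, _, hasDerivAt_sinInt_left h0 t, hasDerivAt_cosInt_left h0 t,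
      hasDerivAt_areaInt_left h0 t, fun h => ?_⟩
    have hpos := two_sub_two_mul_cos_sub_pos (x := ζ * t) (mul_ne_zero h0 ht.ne')
      (by rwa [abs_mul, abs_of_pos ht])
    have hSC : sinInt ζ t * ((t * Real.cos (ζ * t) - sinInt ζ t) / ζ) +
        cosInt ζ t * ((t * Real.sin (ζ * t) - cosInt ζ t) / ζ) =
        (t * Real.sin (ζ * t) / ζ - (sinInt ζ t ^ 2 + cosInt ζ t ^ 2)) / ζ := by
      rw [sinInt_of_ne h0, cosInt]; field_simp; ring
    rw [hSC, sinInt_sq_add_cosInt_sq h0]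
    constructor
    · have : Real.cos (ζ * t) ≠ 1 := fun hc => by
        have hs := Real.sin_sq_add_cos_sq (ζ * t)
        rw [hc] at hs
        have hs0 : Real.sin (ζ * t) = 0 := by nlinarith
        rw [hc, hs0] at hpos
        simp at hpos
      have : 1 - Real.cos (ζ * t) ≠ 0 := sub_ne_zero.2 this.symm
      positivity
    · have e : ((sinInt ζ t - t * Real.cos (ζ * t)) / ζ ^ 2 - areaInt ζ t / ζ) *
          (2 * (1 - Real.cos (ζ * t)) / ζ ^ 2) - 2 * areaInt ζ t *
          ((t * Real.sin (ζ * t) / ζ - 2 * (1 - Real.cos (ζ * t)) / ζ ^ 2) / ζ) =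
          2 * t / ζ ^ 4 * (2 - 2 * Real.cos (ζ * t) - ζ * t * Real.sin (ζ * t)) := by
        rw [areaInt, sinInt_of_ne h0]
        field_simp
        linear_combination (ζ * t) * Real.sin_sq_add_cos_sq (ζ * t)
      rw [e]
      have := hpos.ne'
      positivity

theorem psi_eq (q : Space n) (p : Space n →L[ℝ] ℝ) (t : ℝ) :
    psi t q p = (fun i => (psi t q p).1 i, fun i => (psi t q p).2.1 i,
      vert q (psi t q p) + q.2.2 +
        1 / 2 * ∑ i, (q.1 i * (psi t q p).2.1 i - q.2.1 i * (psi t q p).1 i)) := by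
  refine Prod.ext rfl (Prod.ext rfl ?_)
  simp only [vert]
  ring

/-- The differential at `p` of `ψ_t(q, ·)`, applied to `w`. The last component is expressed through
the left-invariant coordinate `vert q`. -/
theorem fderiv_psi {q : Space n} {p : Space n →L[ℝ] ℝ} {t S' C' K' : ℝ}
    (hS : HasDerivAt (fun ζ => sinInt ζ t) S' (p (0, 0, 1)))
    (hC : HasDerivAt (fun ζ => cosInt ζ t) C' (p (0, 0, 1)))
    (hK : HasDerivAt (fun ζ => areaInt ζ t) K' (p (0, 0, 1))) (w : Space n →L[ℝ] ℝ) :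
    (∀ i, (fderiv ℝ (fun p' => psi t q p') p w).1 i =
      w (frameX i q) * sinInt (p (0, 0, 1)) t - w (frameY i q) * cosInt (p (0, 0, 1)) t +
        (p (frameX i q) * S' - p (frameY i q) * C') * w (0, 0, 1)) ∧
    (∀ i, (fderiv ℝ (fun p' => psi t q p') p w).2.1 i =
      w (frameY i q) * sinInt (p (0, 0, 1)) t + w (frameX i q) * cosInt (p (0, 0, 1)) t +
        (p (frameY i q) * S' + p (frameX i q) * C') * w (0, 0, 1)) ∧
    (fderiv ℝ (fun p' => psi t q p') p w).2.2 -
      1 / 2 * ∑ i, (q.1 i * (fderiv ℝ (fun p' => psi t q p') p w).2.1 i -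
        q.2.1 i * (fderiv ℝ (fun p' => psi t q p') p w).1 i) =
      1 / 2 * (K' * w (0, 0, 1) * ∑ i, (p (frameX i q) ^ 2 + p (frameY i q) ^ 2) +
        2 * areaInt (p (0, 0, 1)) t *
          ∑ i, (p (frameX i q) * w (frameX i q) + p (frameY i q) * w (frameY i q))) := by
  have dev : ∀ v : Space n, DifferentiableAt ℝ (fun p' : Space n →L[ℝ] ℝ => p' v) p := fun v =>
    (ContinuousLinearMap.apply ℝ ℝ v).differentiableAt
  have dS : DifferentiableAt ℝ (fun p' : Space n →L[ℝ] ℝ => sinInt (p' (0, 0, 1)) t) p :=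
    DifferentiableAt.comp (g := fun ζ => sinInt ζ t) p hS.differentiableAt (dev (0, 0, 1))
  have dC : DifferentiableAt ℝ (fun p' : Space n →L[ℝ] ℝ => cosInt (p' (0, 0, 1)) t) p :=
    DifferentiableAt.comp (g := fun ζ => cosInt ζ t) p hC.differentiableAt (dev (0, 0, 1))
  have dK : DifferentiableAt ℝ (fun p' : Space n →L[ℝ] ℝ => areaInt (p' (0, 0, 1)) t) p :=
    DifferentiableAt.comp (g := fun ζ => areaInt ζ t) p hK.differentiableAt (dev (0, 0, 1))
  have dX : ∀ i, DifferentiableAt ℝ (fun p' : Space n →L[ℝ] ℝ => (psi t q p').1 i) p := fun i => by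
    simp only [psi_fst]
    exact (((dev _).fun_mul dS).fun_sub ((dev _).fun_mul dC)).const_add _
  have dY : ∀ i, DifferentiableAt ℝ (fun p' : Space n →L[ℝ] ℝ => (psi t q p').2.1 i) p := by
    intro i
    simp only [psi_snd_fst]
    exact (((dev _).fun_mul dS).fun_add ((dev _).fun_mul dC)).const_add _
  have dV : DifferentiableAt ℝ (fun p' : Space n →L[ℝ] ℝ => vert q (psi t q p')) p := by
    simp only [vert_psi]
    exact (dK.const_mul _).fun_mul (DifferentiableAt.fun_sum fun i _ =>
      ((dev _).fun_pow 2).fun_add ((dev _).fun_pow 2))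
  have dF : DifferentiableAt ℝ (fun p' => psi t q p') p := by
    rw [show (fun p' => psi t q p') = _ from funext fun p' => psi_eq q p' t]
    exact (differentiableAt_pi.2 dX).prodMk ((differentiableAt_pi.2 dY).prodMk
      ((dV.add_const _).fun_add ((DifferentiableAt.fun_sum fun i _ =>
        ((dY i).const_mul _).fun_sub ((dX i).const_mul _)).const_mul _)))
  have hline : HasDerivAt (fun s : ℝ => p + s • w) w 0 := by
    simpa using ((hasDerivAt_id (0 : ℝ)).smul_const w).const_add p
  have hp0 : p + (0 : ℝ) • w = p := by simp
  have hc : HasDerivAt (fun s : ℝ => psi t q (p + s • w)) (fderiv ℝ (fun p' => psi t q p') p w) 0 :=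
    HasFDerivAt.comp_hasDerivAt (l := fun p' => psi t q p') (f := fun s : ℝ => p + s • w) 0
      (by rw [hp0]; exact dF.hasFDerivAt) hline
  have hev : ∀ v : Space n, HasDerivAt (fun s : ℝ => (p + s • w) v) (w v) 0 := fun v => by
    simpa using ((hasDerivAt_id (0 : ℝ)).mul_const (w v)).const_add (p v)
  have hS0 : HasDerivAt (fun s : ℝ => sinInt ((p + s • w) (0, 0, 1)) t) (S' * w (0, 0, 1)) 0 :=
    HasDerivAt.comp (h₂ := fun ζ => sinInt ζ t) 0 (by rw [hp0]; exact hS) (hev (0, 0, 1))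
  have hC0 : HasDerivAt (fun s : ℝ => cosInt ((p + s • w) (0, 0, 1)) t) (C' * w (0, 0, 1)) 0 :=
    HasDerivAt.comp (h₂ := fun ζ => cosInt ζ t) 0 (by rw [hp0]; exact hC) (hev (0, 0, 1))
  have hK0 : HasDerivAt (fun s : ℝ => areaInt ((p + s • w) (0, 0, 1)) t) (K' * w (0, 0, 1)) 0 :=
    HasDerivAt.comp (h₂ := fun ζ => areaInt ζ t) 0 (by rw [hp0]; exact hK) (hev (0, 0, 1))
  refine ⟨fun i => ?_, fun i => ?_, ?_⟩
  · have h1 := hasDerivAt_pi.1 hc.fst i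
    simp only [psi_fst] at h1
    refine h1.unique (((((hev _).fun_mul hS0).fun_sub ((hev _).fun_mul hC0)).const_add
      _).congr_deriv ?_)
    rw [hp0]; ring
  · have h1 := hasDerivAt_pi.1 hc.snd.fst i
    simp only [psi_snd_fst] at h1
    refine h1.unique (((((hev _).fun_mul hS0).fun_add ((hev _).fun_mul hC0)).const_add
      _).congr_deriv ?_)
    rw [hp0]; ring
  · have h1 := hasDerivAt_vert (q := q) hc
    simp only [vert_psi] at h1
    refine h1.unique (((hK0.const_mul (1 / 2)).fun_mul (HasDerivAt.fun_sum fun i _ =>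
      ((hev (frameX i q)).fun_pow 2).fun_add ((hev (frameY i q)).fun_pow 2))).congr_deriv ?_)
    rw [hp0, mul_add, mul_assoc (1 / 2), Finset.mul_sum _ _ (2 * _), Finset.mul_sum _ _ (1 / 2),
      Finset.mul_sum _ _ (1 / 2 * areaInt _ _)]
    congr 1
    refine Finset.sum_congr rfl fun i _ => ?_
    push_cast
    ring

theorem covector_eq_zero {q : Space n} {w : Space n →L[ℝ] ℝ} (hX : ∀ i, w (frameX i q) = 0)
    (hY : ∀ i, w (frameY i q) = 0) (hZ : w (0, 0, 1) = 0) : w = 0 := by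
  refine ContinuousLinearMap.ext fun v => ?_
  have hm : v - contactForm q v • (0, 0, 1) ∈ distribution q := by
    change contactForm q _ = 0
    rw [map_sub, map_smul]
    simp [contactForm_apply]
  have h := congrArg w (eq_sum_of_mem_distribution hm)
  rw [map_sub, map_smul, hZ, map_add, map_sum, map_sum] at h
  simpa only [map_smul, hX, hY, smul_zero, Finset.sum_const_zero, sub_zero, add_zero,
    zero_apply] using h

theorem bijective_of_injective (L : (Space n →L[ℝ] ℝ) →L[ℝ] Space n)
    (h : Function.Injective L) : Function.Bijective L := by
  have e : Module.finrank ℝ (Space n →L[ℝ] ℝ) = Module.finrank ℝ (Space n) := by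
    rw [← (LinearMap.toContinuousLinearMap (𝕜 := ℝ) (E := Space n) (F' := ℝ)).finrank_eq]
    exact Subspace.dual_finrank_eq
  exact ⟨h, (LinearMap.injective_iff_surjective_of_finrank_eq_finrank e
    (f := (L : (Space n →L[ℝ] ℝ) →ₗ[ℝ] Space n))).1 h⟩

theorem bijective_fderiv_psi {q : Space n} {p : Space n →L[ℝ] ℝ}
    (hp : ∑ i, (p (frameX i q) ^ 2 + p (frameY i q) ^ 2) = 1) {t : ℝ} (ht : 0 < t)
    (h : |p (0, 0, 1)| * t < 2 * Real.pi) :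
    Function.Bijective (fderiv ℝ (fun p' => psi t q p') p) := by
  obtain ⟨S', C', K', hS, hC, hK, hne⟩ := exists_hasDerivAt_left (p (0, 0, 1)) ht
  obtain ⟨hN, hJ⟩ := hne h
  refine bijective_of_injective _ ((injective_iff_map_eq_zero _).2 fun w hw => ?_)
  obtain ⟨e1, e2, e3⟩ := fderiv_psi (q := q) hS hC hK w
  rw [hw] at e1 e2 e3
  simp only [Prod.fst_zero, Prod.snd_zero, Pi.zero_apply, mul_zero, sub_zero,
    Finset.sum_const_zero, hp, mul_one] at e1 e2 e3
  set S := sinInt (p (0, 0, 1)) t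
  set C := cosInt (p (0, 0, 1)) t
  set K := areaInt (p (0, 0, 1)) t
  set z := w (0, 0, 1) with hz
  -- The horizontal equations, solved for `w(Xᵢ)`, `w(Yᵢ)` and paired with `p(Xᵢ)`, `p(Yᵢ)`.
  have h1 : (S ^ 2 + C ^ 2) * ∑ i, (p (frameX i q) * w (frameX i q) +
      p (frameY i q) * w (frameY i q)) + (S * S' + C * C') * z = 0 := by
    rw [← mul_one ((S * S' + C * C') * z), ← hp, Finset.mul_sum, Finset.mul_sum,
      ← Finset.sum_add_distrib]
    refine Finset.sum_eq_zero fun i _ => ?_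
    linear_combination -(p (frameX i q) * S - p (frameY i q) * C) * e1 i -
      (p (frameY i q) * S + p (frameX i q) * C) * e2 i
  have hz0 : z = 0 := by
    refine (mul_eq_zero.1 ?_).resolve_left hJ
    linear_combination 2 * K * (-h1) - 2 * (S ^ 2 + C ^ 2) * e3
  refine covector_eq_zero (q := q) (fun i => ?_) (fun i => ?_) hz0
  · refine (mul_eq_zero.1 ?_).resolve_left hN
    have a1 := e1 i
    have a2 := e2 i
    rw [hz0] at a1 a2
    linear_combination -S * a1 - C * a2
  · refine (mul_eq_zero.1 ?_).resolve_left hN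
    have a1 := e1 i
    have a2 := e2 i
    rw [hz0] at a1 a2
    linear_combination -S * a2 + C * a1

/-- When the geodesic closes up in the `(x, y)` space, rotating the initial horizontal covector
about the vertical axis does not move the endpoint to first order. -/
theorem not_bijective_fderiv_psi {q : Space n} {p : Space n →L[ℝ] ℝ}
    (hp : ∑ i, (p (frameX i q) ^ 2 + p (frameY i q) ^ 2) = 1) {t : ℝ} (ht : 0 < t)
    (h : |p (0, 0, 1)| * t = 2 * Real.pi) :
    ¬ Function.Bijective (fderiv ℝ (fun p' => psi t q p') p) := by
  intro hbij
  have h0 : p (0, 0, 1) ≠ 0 := fun h0 => by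
    rw [h0, abs_zero, zero_mul] at h; linarith [Real.pi_pos]
  obtain ⟨S', C', K', hS, hC, hK, -⟩ := exists_hasDerivAt_left (p (0, 0, 1)) ht
  have hC0 : cosInt (p (0, 0, 1)) t = 0 := by
    rw [cosInt, ← cos_abs_mul, h, Real.cos_two_pi, sub_self, zero_div]
  have hS0 : sinInt (p (0, 0, 1)) t = 0 := by
    rw [sinInt_of_ne h0, ← sin_abs_mul_div, h, Real.sin_two_pi, zero_div]
  set w : Space n →L[ℝ] ℝ := ∑ i, (-p (frameY i q)) •
      (ContinuousLinearMap.proj (R := ℝ) (φ := fun _ : Fin n => ℝ) i).comp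
        (ContinuousLinearMap.fst ℝ (Fin n → ℝ) ((Fin n → ℝ) × ℝ)) +
    ∑ i, p (frameX i q) • ((ContinuousLinearMap.proj (R := ℝ) (φ := fun _ : Fin n => ℝ) i).comp
      (ContinuousLinearMap.fst ℝ (Fin n → ℝ) ℝ)).comp
        (ContinuousLinearMap.snd ℝ (Fin n → ℝ) ((Fin n → ℝ) × ℝ)) with hw
  have hwv : ∀ v : Space n, w v = ∑ i, -p (frameY i q) * v.1 i + ∑ i, p (frameX i q) * v.2.1 i :=
    fun v => by simp [hw, sum_apply]
  have wX : ∀ i, w (frameX i q) = -p (frameY i q) := fun i => by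
    rw [hwv]; simp [frameX, Pi.single_apply]
  have wY : ∀ i, w (frameY i q) = p (frameX i q) := fun i => by
    rw [hwv]; simp [frameY, Pi.single_apply]
  have wZ : w (0, 0, 1) = 0 := by rw [hwv]; simp
  obtain ⟨e1, e2, e3⟩ := fderiv_psi (q := q) hS hC hK w
  simp only [hS0, hC0, wZ, mul_zero, sub_zero, add_zero] at e1 e2
  have hsum : ∑ i, (p (frameX i q) * w (frameX i q) + p (frameY i q) * w (frameY i q)) = 0 :=
    Finset.sum_eq_zero fun i _ => by rw [wX, wY]; ring
  simp only [e1, e2, hsum, wZ, mul_zero, zero_mul, sub_zero, add_zero,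
    Finset.sum_const_zero] at e3
  have hker : fderiv ℝ (fun p' => psi t q p') p w = 0 :=
    Prod.ext (funext e1) (Prod.ext (funext e2) e3)
  have hw0 : w = 0 := hbij.1 (hker.trans (map_zero _).symm)
  have : ∑ i, (p (frameX i q) ^ 2 + p (frameY i q) ^ 2) = 0 :=
    Finset.sum_eq_zero fun i _ => by
      have a1 := wX i
      have a2 := wY i
      rw [hw0, zero_apply] at a1 a2
      rw [← a2, neg_eq_zero.1 a1.symm]; ring
  rw [hp] at this
  exact one_ne_zero this

/-! ### Cut time and first conjugate time -/

theorem mem_minimizingTimes_iff {q : Space n} {p : Space n →L[ℝ] ℝ} (hp : IsUnitHorizontal q p)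
    {T : ℝ} : T ∈ minimizingTimes q p ↔ 0 < T ∧ |p (0, 0, 1)| * T ≤ 2 * Real.pi :=
  ⟨fun h => ⟨h.1, not_lt.1 fun hlt => not_isLengthMinimizing_psi (sum_sq_eq_one hp) h.1 hlt h.2⟩,
    fun h => ⟨h.1, isLengthMinimizing_psi (sum_sq_eq_one hp) h.1 h.2⟩⟩

theorem cutTime_eq_of_isGreatest {q : Space n} {p : Space n →L[ℝ] ℝ} {T : ℝ}
    (h : IsGreatest (minimizingTimes q p) T) : cutTime q p = ENNReal.ofReal T :=
  le_antisymm (iSup₂_le fun _ hs => ENNReal.ofReal_le_ofReal (h.2 hs))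
    (le_iSup₂_of_le T h.1 le_rfl)

theorem firstConjugateTime_eq_of_isLeast {q : Space n} {p : Space n →L[ℝ] ℝ} {t : ℝ}
    (h : IsLeast (conjugateTimes q p) t) : firstConjugateTime q p = ENNReal.ofReal t :=
  le_antisymm (iInf₂_le_of_le t h.1 le_rfl)
    (le_iInf₂ fun _ hs => ENNReal.ofReal_le_ofReal (h.2 hs))

end Heisenberg

end

theorem theorem6p2 (n : ℕ) (q : Heisenberg.Space n) (p : Heisenberg.Space n →L[ℝ] ℝ)
    (hp : Heisenberg.IsUnitHorizontal q p) :
    (Heisenberg.minimizingTimes q p).Nonempty ∧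
    Heisenberg.cutTime q p = Heisenberg.firstConjugateTime q p ∧
    (Heisenberg.cutTime q p ≠ ⊤ →
      IsGreatest (Heisenberg.minimizingTimes q p) (Heisenberg.cutTime q p).toReal ∧
      IsLeast (Heisenberg.conjugateTimes q p) (Heisenberg.firstConjugateTime q p).toReal) := by
  have h1 := Heisenberg.sum_sq_eq_one hp
  rcases eq_or_ne (p (0, 0, 1)) 0 with h0 | h0
  · have hmin : ∀ T, 0 < T → T ∈ Heisenberg.minimizingTimes q p := fun T hT =>
      (Heisenberg.mem_minimizingTimes_iff hp).2 ⟨hT, by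
        rw [h0, abs_zero, zero_mul]; positivity⟩
    have hconj : Heisenberg.conjugateTimes q p = ∅ :=
      Set.eq_empty_of_forall_notMem fun t ht => ht.2 <|
        Heisenberg.bijective_fderiv_psi h1 ht.1 (by rw [h0, abs_zero, zero_mul]; positivity)
    have hcut : Heisenberg.cutTime q p = ⊤ := by
      refine ENNReal.eq_top_of_forall_nnreal_le fun r => ?_
      refine le_iSup₂_of_le (r + 1 : ℝ) (hmin _ (by positivity)) ?_
      rw [← ENNReal.ofReal_coe_nnreal]
      exact ENNReal.ofReal_le_ofReal (by linarith)
    refine ⟨⟨1, hmin 1 one_pos⟩, ?_, fun h => absurd hcut h⟩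
    rw [hcut, Heisenberg.firstConjugateTime, hconj]
    simp
  · have hm : 0 < |p (0, 0, 1)| := abs_pos.2 h0
    have hT : 0 < 2 * Real.pi / |p (0, 0, 1)| := by positivity
    have hmul : |p (0, 0, 1)| * (2 * Real.pi / |p (0, 0, 1)|) = 2 * Real.pi := by field_simp
    have hg : IsGreatest (Heisenberg.minimizingTimes q p) (2 * Real.pi / |p (0, 0, 1)|) :=
      ⟨(Heisenberg.mem_minimizingTimes_iff hp).2 ⟨hT, hmul.le⟩, fun T h => by
        rw [le_div_iff₀ hm, mul_comm]
        exact ((Heisenberg.mem_minimizingTimes_iff hp).1 h).2⟩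
    have hl : IsLeast (Heisenberg.conjugateTimes q p) (2 * Real.pi / |p (0, 0, 1)|) :=
      ⟨⟨hT, Heisenberg.not_bijective_fderiv_psi h1 hT hmul⟩, fun t ht => by
        by_contra! hlt
        rw [lt_div_iff₀ hm, mul_comm] at hlt
        exact ht.2 (Heisenberg.bijective_fderiv_psi h1 ht.1 hlt)⟩
    rw [Heisenberg.cutTime_eq_of_isGreatest hg, Heisenberg.firstConjugateTime_eq_of_isLeast hl,
      ENNReal.toReal_ofReal hT.le]
    exact ⟨⟨_, hg.1⟩, rfl, fun _ => ⟨hg, hl⟩⟩
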